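/- Let $H$ be a complex Hilbert space with inner product $\langle\cdot,\cdot\rangle$ and let $A:\mathfrak D(A)\subset H\to H$ be a strictly positive self-adjoint operator with compact inverse. Let $\alpha,\beta,a,\eta,\varphi\in\mathbb R$ with $\alpha>0$, $\beta>\alpha$, $a\neq 0$ and $0\le\varphi\le 1$. Let $\mathbb H=\mathfrak D(A^{1/2})\times\mathfrak D(A^{1/2})\times H\times H$, a Hilbert space with the norm $$\|(u,v,w,\theta)\|_{\mathbb H}^2=a^2\alpha(\beta-\alpha)\|A^{1/2}v\|^2+a^2\|A^{1/2}u+\alpha A^{1/2}v\|^2+\|v+\alpha w\|^2+\|\theta\|^2$$ and the inner product inducing it. Let $\mathbb B$ be the operator on $\mathbb H$ with domain $$\mathfrak D(\mathbb B)=\{(u,v,w,\theta)\in\mathbb H:\ v,w\in\mathfrak D(A^{1/2}),\ a^2u+a^2\beta v-\eta A^{\varphi-1}\theta\in\mathfrak D(A),\ \eta A^{\varphi-1}v+\alpha\eta A^{\varphi-1}w+\theta\in\mathfrak D(A)\}$$ given by $$\mathbb B(u,v,w,\theta)=\Big(v,\ w,\ -\tfrac1\alpha\big[A(a^2u+a^2\beta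 v-\eta A^{\varphi-1}\theta)+w\big],\ -A(\eta A^{\varphi-1}v+\alpha\eta A^{\varphi-1}w+\theta)\Big).$$ Then $\mathbb B$ is densely defined and dissipative, $0\in\rho(\mathbb B)$, and $\mathbb B$ is the infinitesimal generator of a $C_0$-semigroup of contractions $(S(t))_{t\ge0}$ on $\mathbb H$. For every $U_0\in\mathbb H$ there is a unique weak solution $U\in C([0,\infty),\mathbb H)$ of $\frac{d}{dt}U(t)=\mathbb BU(t)$, $U(0)=U_0$ (that is, for every $V\in\mathfrak D(\mathbb B^*)$ the function $t\mapsto\langle U(t),V\rangle_{\mathbb H}$ is differentiable on $[0,\infty)$ with derivative $\langle U(t),\mathbb B^*V\rangle_{\mathbb H}$), and $U(t)=S(t)U_0$. Furthermore, if $k\in\mathbb N$ and $U_0\in\mathfrak D(\mathbb B^k)$, then $$U\in\bigcap_{j=0}^kC^{k-j}\big([0,\infty),\mathfrak D(\mathbb B^j)\big),$$ where $\mathfrak D(\mathbb B^j)$ carries the graph norm of $\mathbb B^j$. -/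

import Mathlib

open scoped NNReal Topology InnerProductSpace LinearPMap

noncomputable section

namespace MGTFourier

/-! ### Unbounded operators on a complex Hilbert space -/

section Operators

variable {E : Type*} [NormedAddCommGroup E] [InnerProductSpace ℂ E]

/-- `T` is an everywhere defined bounded two-sided inverse of the (unbounded) operator `A`. -/
structure IsBoundedInverse (A : E →ₗ.[ℂ] E) (T : E →L[ℂ] E) : Prop where
  left_inv : ∀ x : A.domain, T (A x) = x
  right_inv : ∀ y : E, ∃ h : T y ∈ A.domain, A ⟨T y, h⟩ = y

open scoped Classical in
/-- The bounded operator `A⁻¹` (and `0` if `A` has no bounded inverse). -/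
def boundedInverse (A : E →ₗ.[ℂ] E) : E →L[ℂ] E :=
  if h : ∃ T, IsBoundedInverse A T then h.choose else 0

lemma boundedInverse_spec {A : E →ₗ.[ℂ] E} (h : ∃ T, IsBoundedInverse A T) :
    IsBoundedInverse A (boundedInverse A) := by
  rw [boundedInverse, dif_pos h]
  exact h.choose_spec

/-- The resolvent set of an operator: those `z` for which `z - A` is a bijection of the domain
of `A` onto the space, with bounded inverse. -/
def resolventSet (A : E →ₗ.[ℂ] E) : Set ℂ :=
  {z | ∃ R : E →L[ℂ] E, (∀ x : A.domain, R (z • (x : E) - A x) = x) ∧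
    ∀ y : E, ∃ h : R y ∈ A.domain, z • R y - A ⟨R y, h⟩ = y}

/-- Dissipativity: `Re ⟨A x, x⟩ ≤ 0` on the domain of `A`. -/
def IsDissipative (A : E →ₗ.[ℂ] E) : Prop :=
  ∀ x : A.domain, (inner ℂ (A x) (x : E)).re ≤ 0

/-- The composition `S T`, with domain `{x ∈ D(T) | T x ∈ D(S)}`. -/
def opComp (S T : E →ₗ.[ℂ] E) : E →ₗ.[ℂ] E where
  domain :=
    { carrier := {x | ∃ hx : x ∈ T.domain, T ⟨x, hx⟩ ∈ S.domain}
      zero_mem' := ⟨T.domain.zero_mem, by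
        have : T ⟨0, T.domain.zero_mem⟩ = 0 := LinearPMap.map_zero T
        rw [this]
        exact S.domain.zero_mem⟩
      add_mem' := fun {x y} ⟨hx, hx'⟩ ⟨hy, hy'⟩ => ⟨T.domain.add_mem hx hy, by
        have : T ⟨x + y, T.domain.add_mem hx hy⟩ = T ⟨x, hx⟩ + T ⟨y, hy⟩ :=
          LinearPMap.map_add T ⟨x, hx⟩ ⟨y, hy⟩
        rw [this]
        exact S.domain.add_mem hx' hy'⟩
      smul_mem' := fun c x ⟨hx, hx'⟩ => ⟨T.domain.smul_mem c hx, by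
        have : T ⟨c • x, T.domain.smul_mem c hx⟩ = c • T ⟨x, hx⟩ :=
          LinearPMap.map_smul T c ⟨x, hx⟩
        rw [this]
        exact S.domain.smul_mem c hx'⟩ }
  toFun :=
    { toFun := fun x => S ⟨T ⟨x, x.2.1⟩, x.2.2⟩
      map_add' := fun x y => by
        rw [← LinearPMap.map_add]
        congr 1
        exact Subtype.ext (LinearPMap.map_add T ⟨x, x.2.1⟩ ⟨y, y.2.1⟩)
      map_smul' := fun c x => by
        rw [RingHom.id_apply, ← LinearPMap.map_smul]
        congr 1
        exact Subtype.ext (LinearPMap.map_smul T c ⟨x, x.2.1⟩) }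

/-- The powers `A⁰ = I`, `Aⁿ⁺¹ = Aⁿ A`, with
`D(Aⁿ⁺¹) = {x ∈ D(A) | A x ∈ D(Aⁿ)}`. -/
def opPow (A : E →ₗ.[ℂ] E) : ℕ → E →ₗ.[ℂ] E
  | 0 => (LinearMap.id : E →ₗ[ℂ] E).toPMap ⊤
  | n + 1 => opComp (opPow A n) A

/-- `U ∈ Cᵐ([0, ∞), D(A))`, where the domain `D(A)` carries the graph norm. The normed space
`D(A)` is represented by the graph of `A`, a subspace of `E × E`, through `x ↦ (x, A x)`. -/
def ContDiffInDomain (A : E →ₗ.[ℂ] E) (m : ℕ) (U : ℝ → E) : Prop :=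
  ∃ f : ℝ → A.graph, ContDiffOn ℝ m f (Set.Ici 0) ∧ ∀ t ∈ Set.Ici (0 : ℝ), (f t).1.1 = U t

/-- `S` is a strongly continuous semigroup of contractions. -/
structure IsC0ContractionSemigroup (S : ℝ≥0 → E →L[ℂ] E) : Prop where
  zero : S 0 = ContinuousLinearMap.id ℂ E
  add : ∀ s t, S (s + t) = (S s).comp (S t)
  tendsto_zero : ∀ x, Filter.Tendsto (fun t => S t x) (𝓝 0) (𝓝 x)
  contraction : ∀ t, ‖S t‖ ≤ 1

/-- `A` is the infinitesimal generator of `S`: `x ∈ D(A)` and `A x = y` if and only if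
`(S(t) x - x) / t → y` as `t → 0⁺`. -/
def IsGenerator (A : E →ₗ.[ℂ] E) (S : ℝ≥0 → E →L[ℂ] E) : Prop :=
  ∀ x y : E, (∃ hx : x ∈ A.domain, A ⟨x, hx⟩ = y) ↔
    Filter.Tendsto (fun t : ℝ≥0 => (t : ℝ)⁻¹ • (S t x - x)) (𝓝[>] 0) (𝓝 y)

/-- `U ∈ C([0, ∞), E)` is a weak solution of `U' = A U`, `U(0) = U₀`: for each `V` in the domain
of the adjoint `A†`, the function `t ↦ ⟨V, U(t)⟩` is differentiable on `[0, ∞)` with derivative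
`⟨A† V, U(t)⟩`. (Only the restriction of `U` to `[0, ∞)` matters.) -/
structure IsWeakSolution [CompleteSpace E] (A : E →ₗ.[ℂ] E) (U₀ : E) (U : ℝ → E) : Prop where
  continuousOn : ContinuousOn U (Set.Ici 0)
  initial : U 0 = U₀
  weak : ∀ V : A†.domain, ∀ t ∈ Set.Ici (0 : ℝ),
    HasDerivWithinAt (fun s => inner ℂ (V : E) (U s)) (inner ℂ (A† V) (U t)) (Set.Ici 0) t

end Operators

section Powers

variable {H : Type*} [NormedAddCommGroup H] [InnerProductSpace ℂ H] [CompleteSpace H]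

/-- The bounded operator `A⁻ˢ = (A⁻¹)ˢ`, `s ≥ 0`, for a strictly positive self-adjoint
operator `A`, through the continuous functional calculus of the bounded positive
operator `A⁻¹`. -/
def negPow (A : H →ₗ.[ℂ] H) (s : ℝ) : H →L[ℂ] H := boundedInverse A ^ s

/-- The operator `Aˢ = (A⁻ˢ)⁻¹`, `s ≥ 0`, with domain `D(Aˢ)` the range of `A⁻ˢ`, for a strictly
positive self-adjoint operator `A`. -/
def posPow (A : H →ₗ.[ℂ] H) (s : ℝ) : H →ₗ.[ℂ] H :=
  ((negPow A s : H →ₗ[ℂ] H).toPMap ⊤).inverse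

end Powers

/-! ### The system -/

/-- The data of the abstract system
`α u''' + u'' + a² A u + a² β A u' - η A^φ θ = 0`, `θ' + A θ + α η A^φ u'' + η A^φ u' = 0`:
a strictly positive self-adjoint operator `A` with compact inverse on the complex Hilbert space
`H`, and real constants. -/
structure System (H : Type*) [NormedAddCommGroup H] [InnerProductSpace ℂ H]
    [CompleteSpace H] where
  A : H →ₗ.[ℂ] H
  isSelfAdjoint : IsSelfAdjoint A
  strictlyPositive : ∃ c : ℝ, 0 < c ∧
    ∀ x : A.domain, c * ‖(x : H)‖ ^ 2 ≤ (inner ℂ (A x) (x : H)).re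
  compactInverse : ∃ T : H →L[ℂ] H, IsBoundedInverse A T ∧ IsCompactOperator T
  α : ℝ
  β : ℝ
  a : ℝ
  η : ℝ
  φ : ℝ
  α_pos : 0 < α
  α_lt_β : α < β
  a_ne_zero : a ≠ 0
  φ_nonneg : 0 ≤ φ
  φ_le_one : φ ≤ 1

namespace System

variable {H : Type*} [NormedAddCommGroup H] [InnerProductSpace ℂ H] [CompleteSpace H]
variable (D : System H)

/-- The operator `A^{1/2}`. -/
def sqrtA : H →ₗ.[ℂ] H := posPow D.A (1 / 2)

lemma inv_spec : IsBoundedInverse D.A (boundedInverse D.A) :=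
  boundedInverse_spec (D.compactInverse.imp fun _ h => h.1)

lemma A_symm (x y : D.A.domain) : inner ℂ (D.A x) (y : H) = inner ℂ (x : H) (D.A y) := by
  have hd := D.isSelfAdjoint.dense_domain
  have h := LinearPMap.adjoint_isFormalAdjoint hd
  rw [LinearPMap.isSelfAdjoint_def.1 D.isSelfAdjoint] at h
  exact h x y

lemma inv_nonneg : 0 ≤ boundedInverse D.A := by
  rw [ContinuousLinearMap.nonneg_iff_isPositive, ContinuousLinearMap.isPositive_iff_complex]
  intro y
  obtain ⟨h, hy⟩ := D.inv_spec.right_inv y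
  obtain ⟨c, hc, hpos⟩ := D.strictlyPositive
  have h1 := hpos ⟨_, h⟩
  have h2 := D.A_symm ⟨_, h⟩ ⟨_, h⟩
  rw [hy] at h1 h2
  have h3 : inner ℂ (boundedInverse D.A y) y =
      starRingEnd ℂ (inner ℂ (boundedInverse D.A y) y) := by
    rw [inner_conj_symm]; exact h2.symm
  refine ⟨?_, ?_⟩
  · exact (Complex.conj_eq_iff_re.1 h3.symm)
  · rw [← h2]
    exact le_trans (by positivity) h1

lemma inv_injective : Function.Injective (boundedInverse D.A) := by
  intro x y hxy
  obtain ⟨h, hx⟩ := D.inv_spec.right_inv x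
  obtain ⟨h', hy⟩ := D.inv_spec.right_inv y
  rw [← hx, ← hy]
  congr 1
  exact Subtype.ext hxy

lemma negPow_half_sq (x : H) :
    negPow D.A (1 / 2) (negPow D.A (1 / 2) x) = boundedInverse D.A x := by
  have h : negPow D.A (1 / 2) * negPow D.A (1 / 2) = boundedInverse D.A := by
    have h1 : negPow D.A (1 / 2) = CFC.sqrt (boundedInverse D.A) := by
      rw [negPow, CFC.sqrt_eq_rpow]
    rw [h1]
    exact CFC.sqrt_mul_sqrt_self _ D.inv_nonneg
  rw [← h]
  rfl

lemma negPow_half_injective : Function.Injective (negPow D.A (1 / 2)) := by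
  intro x y hxy
  apply D.inv_injective
  rw [← negPow_half_sq, ← negPow_half_sq, hxy]

lemma negPow_half_ker :
    ((negPow D.A (1 / 2) : H →ₗ[ℂ] H).toPMap ⊤).toFun.ker = ⊥ := by
  rw [LinearMap.ker_eq_bot]
  intro x y hxy
  exact Subtype.ext (D.negPow_half_injective hxy)

lemma negPow_half_mem (x : H) : negPow D.A (1 / 2) x ∈ D.sqrtA.domain := by
  rw [sqrtA, posPow, LinearPMap.inverse_domain]
  exact ⟨⟨x, trivial⟩, rfl⟩

lemma sqrtA_negPow (x : H) :
    D.sqrtA ⟨negPow D.A (1 / 2) x, D.negPow_half_mem x⟩ = x :=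
  LinearPMap.inverse_apply_eq D.negPow_half_ker
    (x := (⟨x, trivial⟩ : ((negPow D.A (1 / 2) : H →ₗ[ℂ] H).toPMap ⊤).domain)) rfl

lemma negPow_sqrtA (x : D.sqrtA.domain) : negPow D.A (1 / 2) (D.sqrtA x) = x := by
  obtain ⟨x, hx⟩ := x
  have hx' := hx
  rw [sqrtA, posPow, LinearPMap.inverse_domain] at hx'
  obtain ⟨z, rfl⟩ := hx'
  have := D.sqrtA_negPow (z : H)
  exact congrArg (negPow D.A (1 / 2)) this

lemma sqrtA_eq_zero {x : D.sqrtA.domain} (h : D.sqrtA x = 0) : x = 0 := by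
  have := D.negPow_sqrtA x
  rw [h, map_zero] at this
  exact Subtype.ext this.symm

/-- The phase space `ℍ = D(A^{1/2}) × D(A^{1/2}) × H × H`, with elements `(u, v, w, θ)`. -/
def PhaseSpace : Type _ := D.sqrtA.domain × D.sqrtA.domain × H × H

instance : AddCommGroup D.PhaseSpace :=
  inferInstanceAs (AddCommGroup (D.sqrtA.domain × D.sqrtA.domain × H × H))

instance : Module ℂ D.PhaseSpace :=
  inferInstanceAs (Module ℂ (D.sqrtA.domain × D.sqrtA.domain × H × H))

/-- The component `u` of `(u, v, w, θ)`. -/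
def u : D.PhaseSpace →ₗ[ℂ] D.sqrtA.domain where
  toFun U := U.1
  map_add' _ _ := rfl
  map_smul' _ _ := rfl

/-- The component `v` of `(u, v, w, θ)`. -/
def v : D.PhaseSpace →ₗ[ℂ] D.sqrtA.domain where
  toFun U := U.2.1
  map_add' _ _ := rfl
  map_smul' _ _ := rfl

/-- The component `w` of `(u, v, w, θ)`. -/
def w : D.PhaseSpace →ₗ[ℂ] H where
  toFun U := U.2.2.1
  map_add' _ _ := rfl
  map_smul' _ _ := rfl

/-- The component `θ` of `(u, v, w, θ)`. -/
def θ : D.PhaseSpace →ₗ[ℂ] H where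
  toFun U := U.2.2.2
  map_add' _ _ := rfl
  map_smul' _ _ := rfl

/-- The inner product of the phase space (antilinear in the first argument). -/
instance : Inner ℂ D.PhaseSpace where
  inner U₁ U₂ :=
    ((D.a ^ 2 * D.α * (D.β - D.α) : ℝ) : ℂ) *
        inner ℂ (D.sqrtA (D.v U₁)) (D.sqrtA (D.v U₂))
      + ((D.a ^ 2 : ℝ) : ℂ) *
        inner ℂ (D.sqrtA (D.u U₁) + (D.α : ℂ) • D.sqrtA (D.v U₁))
          (D.sqrtA (D.u U₂) + (D.α : ℂ) • D.sqrtA (D.v U₂))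
      + inner ℂ ((D.v U₁ : H) + (D.α : ℂ) • D.w U₁) ((D.v U₂ : H) + (D.α : ℂ) • D.w U₂)
      + inner ℂ (D.θ U₁) (D.θ U₂)

lemma inner_def (U₁ U₂ : D.PhaseSpace) :
    inner ℂ U₁ U₂ =
      ((D.a ^ 2 * D.α * (D.β - D.α) : ℝ) : ℂ) *
        inner ℂ (D.sqrtA (D.v U₁)) (D.sqrtA (D.v U₂))
      + ((D.a ^ 2 : ℝ) : ℂ) *
        inner ℂ (D.sqrtA (D.u U₁) + (D.α : ℂ) • D.sqrtA (D.v U₁))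
          (D.sqrtA (D.u U₂) + (D.α : ℂ) • D.sqrtA (D.v U₂))
      + inner ℂ ((D.v U₁ : H) + (D.α : ℂ) • D.w U₁) ((D.v U₂ : H) + (D.α : ℂ) • D.w U₂)
      + inner ℂ (D.θ U₁) (D.θ U₂) := rfl

lemma coef_pos : 0 < D.a ^ 2 * D.α * (D.β - D.α) := by
  have := D.α_pos
  have := sub_pos.2 D.α_lt_β
  have := D.a_ne_zero
  positivity

lemma sq_pos : 0 < D.a ^ 2 := by
  have := D.a_ne_zero
  positivity

lemma re_inner_self (U : D.PhaseSpace) :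
    (inner ℂ U U).re = D.a ^ 2 * D.α * (D.β - D.α) * ‖D.sqrtA (D.v U)‖ ^ 2
      + D.a ^ 2 * ‖D.sqrtA (D.u U) + (D.α : ℂ) • D.sqrtA (D.v U)‖ ^ 2
      + ‖(D.v U : H) + (D.α : ℂ) • D.w U‖ ^ 2 + ‖D.θ U‖ ^ 2 := by
  rw [inner_def]
  simp only [inner_self_eq_norm_sq_to_K, Complex.add_re, Complex.re_ofReal_mul]
  norm_cast

lemma ext_of {U W : D.PhaseSpace} (hu : D.u U = D.u W) (hv : D.v U = D.v W)
    (hw : D.w U = D.w W) (hθ : D.θ U = D.θ W) : U = W :=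
  Prod.ext hu (Prod.ext hv (Prod.ext hw hθ))

lemma definite (U : D.PhaseSpace) (h : inner ℂ U U = 0) : U = 0 := by
  have h0 := D.re_inner_self U
  rw [h, Complex.zero_re] at h0
  have c1 := D.coef_pos
  have c2 := D.sq_pos
  have p1 : 0 ≤ D.a ^ 2 * D.α * (D.β - D.α) * ‖D.sqrtA (D.v U)‖ ^ 2 := by positivity
  have p2 : 0 ≤ D.a ^ 2 * ‖D.sqrtA (D.u U) + (D.α : ℂ) • D.sqrtA (D.v U)‖ ^ 2 := by positivity
  have p3 := sq_nonneg ‖(D.v U : H) + (D.α : ℂ) • D.w U‖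
  have p4 := sq_nonneg ‖D.θ U‖
  have e1 : D.a ^ 2 * D.α * (D.β - D.α) * ‖D.sqrtA (D.v U)‖ ^ 2 = 0 := by linarith
  have e2 : D.a ^ 2 * ‖D.sqrtA (D.u U) + (D.α : ℂ) • D.sqrtA (D.v U)‖ ^ 2 = 0 := by linarith
  have e3 : ‖(D.v U : H) + (D.α : ℂ) • D.w U‖ ^ 2 = 0 := by linarith
  have e4 : ‖D.θ U‖ ^ 2 = 0 := by linarith
  have q1 : D.sqrtA (D.v U) = 0 := by
    simpa using (mul_eq_zero.1 e1).resolve_left c1.ne'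
  have q2 : D.sqrtA (D.u U) = 0 := by
    have := (mul_eq_zero.1 e2).resolve_left c2.ne'
    simpa [q1] using this
  have hv : D.v U = 0 := D.sqrtA_eq_zero q1
  have hu : D.u U = 0 := D.sqrtA_eq_zero q2
  have hw : D.w U = 0 := by
    have := D.α_pos.ne'
    simpa [hv, this] using e3
  have hθ : D.θ U = 0 := by simpa using e4
  exact D.ext_of (by rw [hu, map_zero]) (by rw [hv, map_zero]) (by rw [hw, map_zero])
    (by rw [hθ, map_zero])

/-- The inner product axioms. -/
abbrev core : InnerProductSpace.Core ℂ D.PhaseSpace where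
  conj_inner_symm U W := by
    simp only [inner_def, map_add, map_mul, Complex.conj_ofReal, inner_conj_symm]
  re_inner_nonneg U := by
    have h := D.re_inner_self U
    have c1 := D.coef_pos
    have c2 := D.sq_pos
    change 0 ≤ (inner ℂ U U).re
    rw [h]
    positivity
  add_left U V W := by
    simp only [inner_def, map_add, LinearPMap.map_add, Submodule.coe_add, smul_add,
      inner_add_left]
    ring
  smul_left U W r := by
    simp only [inner_def, map_smul, LinearPMap.map_smul, Submodule.coe_smul,
      inner_add_left, inner_smul_left]
    ring
  definite := D.definite

instance : NormedAddCommGroup D.PhaseSpace :=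
  @InnerProductSpace.Core.toNormedAddCommGroup ℂ _ _ _ _ D.core

instance : InnerProductSpace ℂ D.PhaseSpace := InnerProductSpace.ofCore D.core.toCore

lemma norm_sq_eq (U : D.PhaseSpace) :
    ‖U‖ ^ 2 = D.a ^ 2 * D.α * (D.β - D.α) * ‖D.sqrtA (D.v U)‖ ^ 2
      + D.a ^ 2 * ‖D.sqrtA (D.u U) + (D.α : ℂ) • D.sqrtA (D.v U)‖ ^ 2
      + ‖(D.v U : H) + (D.α : ℂ) • D.w U‖ ^ 2 + ‖D.θ U‖ ^ 2 := by
  rw [← D.re_inner_self]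
  exact norm_sq_eq_re_inner (𝕜 := ℂ) U

/-- An isometry of the phase space onto `H⁴`. -/
def toPi : D.PhaseSpace →ₗᵢ[ℂ] PiLp 2 (fun _ : Fin 4 => H) where
  toFun U := WithLp.toLp 2
    ![((√(D.a ^ 2 * D.α * (D.β - D.α)) : ℝ) : ℂ) • D.sqrtA (D.v U),
      (D.a : ℂ) • (D.sqrtA (D.u U) + (D.α : ℂ) • D.sqrtA (D.v U)),
      (D.v U : H) + (D.α : ℂ) • D.w U, D.θ U]
  map_add' U W := by
    ext i
    fin_cases i <;> simp [LinearPMap.map_add, smul_add] <;> abel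
  map_smul' c U := by
    ext i
    fin_cases i <;> simp [LinearPMap.map_smul, smul_add, smul_comm c]
  norm_map' U := by
    rw [← sq_eq_sq₀ (norm_nonneg _) (norm_nonneg _), norm_sq_eq]
    have h := D.coef_pos.le
    change ‖(WithLp.toLp 2 _ : PiLp 2 (fun _ : Fin 4 => H))‖ ^ 2 = _
    rw [PiLp.norm_sq_eq_of_L2]
    simp only [Fin.sum_univ_four, Matrix.cons_val, norm_smul, mul_pow, Complex.norm_real,
      Real.norm_eq_abs, sq_abs, Real.sq_sqrt h]

lemma toPi_surjective : Function.Surjective D.toPi := by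
  intro y
  have hs : ((√(D.a ^ 2 * D.α * (D.β - D.α)) : ℝ) : ℂ) ≠ 0 := by
    exact_mod_cast (Real.sqrt_pos.2 D.coef_pos).ne'
  have ha : (D.a : ℂ) ≠ 0 := by exact_mod_cast D.a_ne_zero
  have hα : (D.α : ℂ) ≠ 0 := by exact_mod_cast D.α_pos.ne'
  set p : H := (((√(D.a ^ 2 * D.α * (D.β - D.α)) : ℝ) : ℂ))⁻¹ • y 0 with hp
  set q : H := (D.a : ℂ)⁻¹ • y 1 - (D.α : ℂ) • p with hq
  let U : D.PhaseSpace := (⟨_, D.negPow_half_mem q⟩, ⟨_, D.negPow_half_mem p⟩,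
    (D.α : ℂ)⁻¹ • (y 2 - negPow D.A (1 / 2) p), y 3)
  have hu : D.sqrtA (D.u U) = q := D.sqrtA_negPow q
  have hv : D.sqrtA (D.v U) = p := D.sqrtA_negPow p
  have hv' : (D.v U : H) = negPow D.A (1 / 2) p := rfl
  have hw : D.w U = (D.α : ℂ)⁻¹ • (y 2 - negPow D.A (1 / 2) p) := rfl
  have hθ : D.θ U = y 3 := rfl
  refine ⟨U, ?_⟩
  change WithLp.toLp 2
    ![((√(D.a ^ 2 * D.α * (D.β - D.α)) : ℝ) : ℂ) • D.sqrtA (D.v U),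
      (D.a : ℂ) • (D.sqrtA (D.u U) + (D.α : ℂ) • D.sqrtA (D.v U)),
      (D.v U : H) + (D.α : ℂ) • D.w U, D.θ U] = y
  rw [hu, hv, hv', hw, hθ]
  ext i
  fin_cases i
  · simp [hp, smul_smul, hs]
  · simp [hq, smul_smul, ha]
  · simp [smul_smul, hα]
  · rfl

instance : CompleteSpace D.PhaseSpace :=
  (LinearIsometryEquiv.ofSurjective D.toPi D.toPi_surjective).toIsometryEquiv.completeSpace

/-- The bounded operator `A^{φ-1}` on `H`. -/
def powφ : H →L[ℂ] H := negPow D.A (1 - D.φ)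

/-- `a² u + a² β v - η A^{φ-1} θ`. -/
def first : D.PhaseSpace →ₗ[ℂ] H :=
  ((D.a ^ 2 : ℝ) : ℂ) • (D.sqrtA.domain.subtype ∘ₗ D.u)
    + ((D.a ^ 2 * D.β : ℝ) : ℂ) • (D.sqrtA.domain.subtype ∘ₗ D.v)
    - (D.η : ℂ) • ((D.powφ : H →ₗ[ℂ] H) ∘ₗ D.θ)

/-- `η A^{φ-1} v + α η A^{φ-1} w + θ`. -/
def second : D.PhaseSpace →ₗ[ℂ] H :=
  (D.η : ℂ) • ((D.powφ : H →ₗ[ℂ] H) ∘ₗ D.sqrtA.domain.subtype ∘ₗ D.v)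
    + ((D.α * D.η : ℝ) : ℂ) • ((D.powφ : H →ₗ[ℂ] H) ∘ₗ D.w)
    + D.θ

/-- The domain of `𝔹`: `(u, v, w, θ) ∈ ℍ` with `v, w ∈ D(A^{1/2})`,
`a² u + a² β v - η A^{φ-1} θ ∈ D(A)` and `η A^{φ-1} v + α η A^{φ-1} w + θ ∈ D(A)`. -/
def domB : Submodule ℂ D.PhaseSpace :=
  D.sqrtA.domain.comap D.w ⊓ D.A.domain.comap D.first ⊓ D.A.domain.comap D.second

/-- The operator `𝔹 (u, v, w, θ) = (v, w, -(a² A u + a² β A v - η A^φ θ + w) / α,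
-(η A^φ v + α η A^φ w + A θ))`, where the two combinations are
`A (a² u + a² β v - η A^{φ-1} θ)` and `A (η A^{φ-1} v + α η A^{φ-1} w + θ)`. -/
def 𝔹 : D.PhaseSpace →ₗ.[ℂ] D.PhaseSpace where
  domain := D.domB
  toFun :=
    { toFun := fun U =>
        (D.v U, ⟨D.w U, U.2.1.1⟩,
          -((D.α : ℂ)⁻¹ • (D.A ⟨D.first U, U.2.1.2⟩ + D.w U)),
          -D.A ⟨D.second U, U.2.2⟩)
      map_add' := fun U W => by
        have h1 : D.A ⟨D.first ↑(U + W), (U + W).2.1.2⟩ =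
            D.A ⟨D.first U, U.2.1.2⟩ + D.A ⟨D.first W, W.2.1.2⟩ := by
          rw [← LinearPMap.map_add]
          exact congrArg _ (Subtype.ext (map_add D.first (U : D.PhaseSpace) W))
        have h2 : D.A ⟨D.second ↑(U + W), (U + W).2.2⟩ =
            D.A ⟨D.second U, U.2.2⟩ + D.A ⟨D.second W, W.2.2⟩ := by
          rw [← LinearPMap.map_add]
          exact congrArg _ (Subtype.ext (map_add D.second (U : D.PhaseSpace) W))
        have h3 : D.w ↑(U + W) = D.w U + D.w W := map_add D.w (U : D.PhaseSpace) W
        refine D.ext_of rfl rfl ?_ ?_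
        · change -((D.α : ℂ)⁻¹ • (D.A ⟨D.first ↑(U + W), (U + W).2.1.2⟩ + D.w ↑(U + W))) =
            -((D.α : ℂ)⁻¹ • (D.A ⟨D.first U, U.2.1.2⟩ + D.w U)) +
            -((D.α : ℂ)⁻¹ • (D.A ⟨D.first W, W.2.1.2⟩ + D.w W))
          rw [h1, h3, ← neg_add, ← smul_add]
          congr 2
          abel
        · change -D.A ⟨D.second ↑(U + W), (U + W).2.2⟩ =
            -D.A ⟨D.second U, U.2.2⟩ + -D.A ⟨D.second W, W.2.2⟩
          rw [h2, neg_add]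
      map_smul' := fun c U => by
        have h1 : D.A ⟨D.first ↑(c • U), (c • U).2.1.2⟩ = c • D.A ⟨D.first U, U.2.1.2⟩ := by
          rw [← LinearPMap.map_smul]
          exact congrArg _ (Subtype.ext (map_smul D.first c (U : D.PhaseSpace)))
        have h2 : D.A ⟨D.second ↑(c • U), (c • U).2.2⟩ = c • D.A ⟨D.second U, U.2.2⟩ := by
          rw [← LinearPMap.map_smul]
          exact congrArg _ (Subtype.ext (map_smul D.second c (U : D.PhaseSpace)))
        have h3 : D.w ↑(c • U) = c • D.w U := map_smul D.w c (U : D.PhaseSpace)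
        refine D.ext_of rfl rfl ?_ ?_
        · change -((D.α : ℂ)⁻¹ • (D.A ⟨D.first ↑(c • U), (c • U).2.1.2⟩ + D.w ↑(c • U))) =
            c • -((D.α : ℂ)⁻¹ • (D.A ⟨D.first U, U.2.1.2⟩ + D.w U))
          rw [h1, h3, ← smul_add, smul_comm, smul_neg]
        · change -D.A ⟨D.second ↑(c • U), (c • U).2.2⟩ = c • -D.A ⟨D.second U, U.2.2⟩
          rw [h2, smul_neg] }

end System

end MGTFourier

end

/-!
With `q = A^{1/2} v` and `k = A^{1/2} θ`, the energy identity
`Re ⟨𝔹 U, U⟩ = -a² (β - α) ‖q‖² - ‖k‖²` makes `𝔹` dissipative, and `𝔹 U = F` can be solved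
explicitly. A surjective dissipative operator is injective with closed graph by Minty's trick, so
`0 ∈ ρ(𝔹)`; coercivity of `1 + (r - r₀) (r₀ - 𝔹)⁻¹` then puts the positive half-line in `ρ(𝔹)`.
The semigroup is the strong limit of the exponentials of the Yosida approximations. A difference
of two weak solutions becomes a classical one under the resolvent `(1 - 𝔹)⁻¹`, hence vanishes, and
regularity is the invariance of the graphs of the powers of `𝔹` under the semigroup.
-/

noncomputable section

namespace MGTFourier

open Filter Set

section PointwiseLimits

variable {𝕜 E F ι : Type*} [NontriviallyNormedField 𝕜] [NormedAddCommGroup E] [NormedSpace 𝕜 E]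
  [NormedAddCommGroup F] [NormedSpace 𝕜 F] {T : ι → E →L[𝕜] F} {C : ℝ≥0}

lemma tendsto_apply_of_dense {l : Filter ι} {G : E →L[𝕜] F} (hT : ∀ i, ‖T i‖₊ ≤ C) {s : Set E}
    (hs : Dense s) (h : ∀ x ∈ s, Tendsto (fun i => T i x) l (𝓝 (G x))) (x : E) :
    Tendsto (fun i => T i x) l (𝓝 (G x)) := by
  have hlip : Equicontinuous fun i => ⇑(T i) :=
    (LipschitzWith.uniformEquicontinuous _ C fun i =>
      (T i).lipschitz.weaken (hT i)).equicontinuous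
  exact hs.induction h (hlip.isClosed_setOfPred_tendsto G.continuous) x

lemma tendsto_apply_of_tendsto {l : Filter ι} (hT : ∀ i, ‖T i‖₊ ≤ C) {u : ι → E} {x : E} {y : F}
    (hu : Tendsto u l (𝓝 x)) (h : Tendsto (fun i => T i x) l (𝓝 y)) :
    Tendsto (fun i => T i (u i)) l (𝓝 y) := by
  have hdiff : Tendsto (fun i => T i (u i - x)) l (𝓝 0) := by
    refine squeeze_zero_norm (fun i => (T i).le_of_opNorm_le (hT i) _) ?_
    simpa using (tendsto_iff_norm_sub_tendsto_zero.1 hu).const_mul (C : ℝ)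
  simpa using hdiff.add h

lemma cauchySeq_apply_of_dense [SemilatticeSup ι] [Nonempty ι] (hT : ∀ i, ‖T i‖₊ ≤ C)
    {s : Set E} (hs : Dense s) (h : ∀ x ∈ s, CauchySeq fun i => T i x) (x : E) :
    CauchySeq fun i => T i x := by
  have hiff (x : E) : CauchySeq (fun i => T i x) ↔
      Tendsto (fun p : ι × ι => (T p.1 - T p.2) x) atTop (𝓝 ((0 : E →L[𝕜] F) x)) := by
    simp only [cauchySeq_iff_tendsto_dist_atTop_0, dist_eq_norm, sub_apply, zero_apply]
    exact tendsto_zero_iff_norm_tendsto_zero.symm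
  have hsub (p : ι × ι) : ‖T p.1 - T p.2‖₊ ≤ C + C :=
    (nnnorm_sub_le _ _).trans (add_le_add (hT p.1) (hT p.2))
  exact (hiff x).2 (tendsto_apply_of_dense hsub hs (fun y hy => (hiff y).1 (h y hy)) x)

lemma exists_tendsto_apply_of_cauchySeq [CompleteSpace E] [CompleteSpace F] [SemilatticeSup ι]
    [Nonempty ι] [(atTop : Filter ι).IsCountablyGenerated]
    (h : ∀ x, CauchySeq fun i => T i x) :
    ∃ G : E →L[𝕜] F, ∀ x, Tendsto (fun i => T i x) atTop (𝓝 (G x)) := by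
  choose G hG using fun x => cauchySeq_tendsto_of_complete (h x)
  exact ⟨continuousLinearMapOfTendsto T (tendsto_pi_nhds.2 hG), hG⟩

end PointwiseLimits

section InnerProduct

variable {𝕜 E : Type*} [RCLike 𝕜] [NormedAddCommGroup E] [InnerProductSpace 𝕜 E]
  [NormedSpace ℝ E]

lemma antitoneOn_norm_of_re_inner_deriv_nonpos {D : Set ℝ} (hD : Convex ℝ D) {f f' : ℝ → E}
    (hf : ∀ t ∈ D, HasDerivWithinAt f (f' t) D t)
    (h : ∀ t ∈ D, RCLike.re (inner 𝕜 (f' t) (f t)) ≤ 0) : AntitoneOn (fun t => ‖f t‖) D := by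
  have hderiv : ∀ t ∈ D,
      HasDerivWithinAt (fun s => ‖f s‖ ^ 2) (2 * RCLike.re (inner 𝕜 (f' t) (f t))) D t := by
    intro t ht
    have hinner := (RCLike.reCLM (K := 𝕜)).hasFDerivAt.comp_hasDerivWithinAt t
      ((hf t ht).inner 𝕜 (hf t ht))
    simp only [Function.comp_def, RCLike.reCLM_apply, ← norm_sq_eq_re_inner, map_add,
      inner_re_symm (f t)] at hinner
    exact hinner.congr_deriv (two_mul _).symm
  have hsq : AntitoneOn (fun t => ‖f t‖ ^ 2) D :=
    antitoneOn_of_hasDerivWithinAt_nonpos hD (fun t ht => (hderiv t ht).continuousWithinAt)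
      (fun t ht => (hderiv t (interior_subset ht)).mono interior_subset)
      fun t ht => by linarith [h t (interior_subset ht)]
  exact fun s hs t ht hst => (sq_le_sq₀ (norm_nonneg _) (norm_nonneg _)).1 (hsq hs ht hst)

lemma hasDerivWithinAt_of_inner [IsScalarTower ℝ 𝕜 E] [CompleteSpace E] {f g : ℝ → E} {a : ℝ}
    (hg : ContinuousOn g (Ici a))
    (h : ∀ V : E, ∀ t ∈ Ici a,
      HasDerivWithinAt (fun s => inner 𝕜 V (f s)) (inner 𝕜 V (g t)) (Ici a) t) :
    ∀ t ∈ Ici a, HasDerivWithinAt f (g t) (Ici a) t := by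
  have hc : Continuous fun t => g (max t a) :=
    hg.comp_continuous (by fun_prop) fun t => le_max_right t a
  set P : ℝ → E := fun t => f a + ∫ s in a..t, g (max s a)
  have hP : ∀ t ∈ Ici a, HasDerivWithinAt P (g t) (Ici a) t := fun t ht => by
    have := ((hc.integral_hasStrictDerivAt a t).hasDerivAt.const_add (f a)).hasDerivWithinAt
      (s := Ici a)
    rwa [max_eq_left ht] at this
  have hfP : EqOn f P (Ici a) := fun t ht => ext_inner_left 𝕜 fun V => by
    have hd : ∀ s ∈ Ici a, HasDerivWithinAt (fun s => inner 𝕜 V (f s) - inner 𝕜 V (P s)) 0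
        (Ici a) s := fun s hs =>
      ((h V s hs).sub (((innerSL 𝕜 V).restrictScalars ℝ).hasFDerivAt.comp_hasDerivWithinAt s
        (hP s hs))).congr_deriv (sub_self _)
    have hconst := constant_of_has_deriv_right_zero (a := a) (b := t)
      (fun s hs => (hd s hs.1).continuousWithinAt.mono Icc_subset_Ici_self)
      (fun s hs => (hd s hs.1).mono (Ici_subset_Ici.2 hs.1)) t ⟨ht, le_rfl⟩
    simpa [P, sub_eq_zero] using hconst
  exact fun t ht => (hP t ht).congr hfP (hfP ht)

end InnerProduct

section Dissipative

variable {E : Type*} [NormedAddCommGroup E] [InnerProductSpace ℂ E] {A : E →ₗ.[ℂ] E}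

lemma re_inner_self_eq_norm_sq (x : E) : (inner ℂ x x).re = ‖x‖ ^ 2 :=
  (norm_sq_eq_re_inner (𝕜 := ℂ) x).symm

lemma re_inner_smul_sub_smul_sub (r s : ℝ) (x y : E) :
    (inner ℂ ((r : ℂ) • x - y) ((s : ℂ) • x - y)).re =
      r * s * ‖x‖ ^ 2 - (r + s) * (inner ℂ y x).re + ‖y‖ ^ 2 := by
  have hsymm : (inner ℂ x y).re = (inner ℂ y x).re := inner_re_symm (𝕜 := ℂ) x y
  simp only [inner_sub_left, inner_sub_right, inner_smul_left, inner_smul_right,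
    Complex.conj_ofReal, Complex.sub_re, Complex.re_ofReal_mul, hsymm, re_inner_self_eq_norm_sq]
  ring

lemma IsDissipative.re_inner_sub_nonpos (hA : IsDissipative A) (x y : A.domain) :
    (inner ℂ (A x - A y) ((x : E) - y)).re ≤ 0 := by
  simpa only [LinearPMap.map_sub, AddSubgroupClass.coe_sub] using hA (x - y)

/-- Minty's trick: test with `w = y - s • z`, where `A z = x - y`, divide by `s` and let
`s → 0⁺`. -/
lemma eq_of_forall_re_inner_nonpos (hA : Function.Surjective A) {x : E} {y : A.domain}
    (h : ∀ w : A.domain, (inner ℂ (A y - A w) (x - w)).re ≤ 0) : x = y := by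
  obtain ⟨z, hz⟩ := hA (x - y)
  have hs : ∀ s > (0 : ℝ), (inner ℂ (x - y) (x - y + (s : ℂ) • (z : E))).re ≤ 0 := by
    intro s hs
    have hw := h (y - (s : ℂ) • z)
    rw [LinearPMap.map_sub, LinearPMap.map_smul, hz, sub_sub_cancel, AddSubgroupClass.coe_sub,
      Submodule.coe_smul, sub_sub_eq_add_sub, add_sub_right_comm, inner_smul_left,
      Complex.conj_ofReal, Complex.re_ofReal_mul] at hw
    exact nonpos_of_mul_nonpos_right hw hs
  have hlim : Tendsto (fun s : ℝ => (inner ℂ (x - y) (x - y + (s : ℂ) • (z : E))).re) (𝓝[>] 0)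
      (𝓝 (‖x - y‖ ^ 2)) := by
    refine (Continuous.tendsto' (by fun_prop) 0 _ ?_).mono_left nhdsWithin_le_nhds
    rw [Complex.ofReal_zero, zero_smul, add_zero, re_inner_self_eq_norm_sq]
  have h0 : ‖x - y‖ ^ 2 ≤ 0 := le_of_tendsto hlim (eventually_mem_nhdsWithin.mono hs)
  simpa [sub_eq_zero] using h0.antisymm (sq_nonneg _)

lemma IsDissipative.zero_mem_resolventSet [CompleteSpace E] (hA : IsDissipative A)
    (hsurj : Function.Surjective A) : 0 ∈ resolventSet A := by
  have hinj : Function.Injective A.toFun := fun x y hxy =>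
    Subtype.ext <| eq_of_forall_re_inner_nonpos hsurj fun w => by
      have hxy : A x = A y := hxy
      exact hxy ▸ hA.re_inner_sub_nonpos x w
  let e : A.domain ≃ₗ[ℂ] E := .ofBijective A.toFun ⟨hinj, hsurj⟩
  have hclosed (u : ℕ → E) (y x : E) (hu : Tendsto u atTop (𝓝 y))
      (hx : Tendsto (fun n => (e.symm (u n) : E)) atTop (𝓝 x)) : x = e.symm y := by
    refine eq_of_forall_re_inner_nonpos hsurj fun w => ?_
    have hlim := (Complex.continuous_re.tendsto _).comp
      ((hu.sub_const (A w)).inner (𝕜 := ℂ) (hx.sub_const (w : E)))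
    rw [show A (e.symm y) = y from e.apply_symm_apply y]
    refine le_of_tendsto hlim (.of_forall fun n => ?_)
    have hn := hA.re_inner_sub_nonpos (e.symm (u n)) w
    rwa [show A (e.symm (u n)) = u n from e.apply_symm_apply (u n)] at hn
  let T : E →L[ℂ] E :=
    .ofSeqClosedGraph (g := A.domain.subtype ∘ₗ e.symm.toLinearMap) hclosed
  refine ⟨-T, fun x => ?_, fun y => ⟨A.domain.neg_mem (e.symm y).2, ?_⟩⟩
  · have hx : T (A x) = x := congrArg Subtype.val (e.symm_apply_apply x)
    rw [zero_smul, zero_sub, map_neg, neg_apply, neg_neg, hx]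
  · have hy : A (-e.symm y) = -y := by
      rw [LinearPMap.map_neg, neg_inj]
      exact e.apply_symm_apply y
    rw [zero_smul, zero_sub, neg_eq_iff_eq_neg]
    exact hy

end Dissipative

section Resolvent

variable {E : Type*} [NormedAddCommGroup E] [InnerProductSpace ℂ E] {A : E →ₗ.[ℂ] E} {z : ℂ}

/-- `R` is the resolvent `(z - A)⁻¹`; the resolvent set consists of the `z` which have one. -/
structure IsResolvent (A : E →ₗ.[ℂ] E) (z : ℂ) (R : E →L[ℂ] E) : Prop where
  left_inv : ∀ x : A.domain, R (z • (x : E) - A x) = x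
  right_inv : ∀ y : E, ∃ h : R y ∈ A.domain, z • R y - A ⟨R y, h⟩ = y

open scoped Classical in
/-- The resolvent `(z - A)⁻¹`, and `0` if `z` is not in the resolvent set. -/
def boundedResolvent (A : E →ₗ.[ℂ] E) (z : ℂ) : E →L[ℂ] E :=
  if h : ∃ R, IsResolvent A z R then h.choose else 0

lemma mem_resolventSet_iff : z ∈ resolventSet A ↔ ∃ R, IsResolvent A z R :=
  exists_congr fun _ => ⟨fun h => ⟨h.1, h.2⟩, fun h => ⟨h.1, h.2⟩⟩

lemma isResolvent_boundedResolvent (hz : z ∈ resolventSet A) :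
    IsResolvent A z (boundedResolvent A z) := by
  have h := mem_resolventSet_iff.1 hz
  rw [boundedResolvent, dif_pos h]
  exact h.choose_spec

namespace IsResolvent

variable {R : E →L[ℂ] E}

lemma mem (h : IsResolvent A z R) (y : E) : R y ∈ A.domain := (h.right_inv y).1

lemma map_apply (h : IsResolvent A z R) (y : E) : A ⟨R y, h.mem y⟩ = z • R y - y := by
  rw [eq_sub_iff_add_eq, ← eq_sub_iff_add_eq', (h.right_inv y).2]

lemma apply_map (h : IsResolvent A z R) (x : A.domain) : R (A x) = z • R x - x := by
  rw [eq_sub_iff_add_eq, ← eq_sub_iff_add_eq', ← map_smul, ← map_sub, h.left_inv]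

lemma injective (h : IsResolvent A z R) : Function.Injective R := fun x y hxy => by
  have hx := h.map_apply x
  simp only [hxy, h.map_apply y, sub_right_inj] at hx
  exact hx.symm

lemma sub_smul_apply_apply (h : IsResolvent A z R) {w : ℂ} {R' : E →L[ℂ] E}
    (h' : IsResolvent A w R') (x : E) : (z - w) • R (R' x) = R' x - R x := by
  have hR := h.apply_map ⟨_, h'.mem x⟩
  rw [h'.map_apply, map_sub, map_smul] at hR
  linear_combination (norm := module) -hR

lemma commute (h : IsResolvent A z R) {w : ℂ} {R' : E →L[ℂ] E} (h' : IsResolvent A w R') :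
    Commute R R' := by
  ext x
  rcases eq_or_ne z w with rfl | hne
  · have hRR' : R = R' := by
      ext y
      have h0 := h.sub_smul_apply_apply h' y
      rw [sub_self, zero_smul] at h0
      exact (sub_eq_zero.1 h0.symm).symm
    rw [hRR']
  · refine smul_right_injective E (sub_ne_zero.2 hne) ?_
    have h1 := h.sub_smul_apply_apply h' x
    have h2 := h'.sub_smul_apply_apply h x
    simp only [mul_apply_eq_comp]
    linear_combination (norm := module) h1 + h2

lemma re_mul_norm_le (h : IsResolvent A z R) (hA : IsDissipative A) (y : E) :
    z.re * ‖R y‖ ≤ ‖y‖ := by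
  have hdiss : ‖R y‖ ^ 2 * z.re ≤ (inner ℂ y (R y)).re := by
    simpa [h.map_apply, inner_sub_left, inner_smul_left, ← Complex.ofReal_pow] using
      hA ⟨R y, h.mem y⟩
  have hCS : (inner ℂ y (R y)).re ≤ ‖y‖ * ‖R y‖ := re_inner_le_norm (𝕜 := ℂ) y (R y)
  rcases (norm_nonneg (R y)).eq_or_lt with h0 | h0
  · simp [← h0]
  · nlinarith

/-- The operator `1 + (r - r₀) (r₀ - A)⁻¹` is coercive: at `z = (r₀ - A) x` its quadratic form is
`Re ⟨(r - A) x, (r₀ - A) x⟩`. -/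
lemma isUnit_one_add_smul [CompleteSpace E] {r₀ : ℝ} (h : IsResolvent A r₀ R)
    (hA : IsDissipative A) (hr₀ : 0 ≤ r₀) {r : ℝ} (hr : 0 < r) :
    IsUnit (1 + ((r : ℂ) - r₀) • R) := by
  refine ContinuousLinearMap.isUnit_of_forall_le_norm_inner_map _
    (c := ⟨r / (r + r₀), by positivity⟩) (show 0 < r / (r + r₀) by positivity) fun y => ?_
  set x : A.domain := ⟨R y, h.mem y⟩
  have hy : y = (r₀ : ℂ) • (x : E) - A x := by rw [h.map_apply, sub_sub_cancel]
  have hGy : (1 + ((r : ℂ) - r₀) • R) y = (r : ℂ) • (x : E) - A x := by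
    rw [h.map_apply, add_apply, one_apply_eq_self, smul_apply]
    module
  have hdiss := hA x
  have hnorm : ‖y‖ ^ 2 = r₀ * r₀ * ‖(x : E)‖ ^ 2 - (r₀ + r₀) * (inner ℂ (A x) (x : E)).re
      + ‖A x‖ ^ 2 := by
    rw [← re_inner_smul_sub_smul_sub, ← hy, re_inner_self_eq_norm_sq]
  refine le_trans ?_ (Complex.re_le_norm _)
  rw [hGy]
  nth_rewrite 2 [hy]
  rw [re_inner_smul_sub_smul_sub, hnorm]
  change _ * (r / (r + r₀)) ≤ _
  rw [mul_div_assoc', div_le_iff₀ (by positivity)]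
  nlinarith [mul_nonneg hr₀ (sq_nonneg ‖A x‖), mul_nonneg (sq_nonneg r) (neg_nonneg.2 hdiss),
    mul_nonneg (sq_nonneg r₀) (neg_nonneg.2 hdiss),
    mul_nonneg (mul_nonneg hr.le hr₀) (mul_nonneg hr.le (sq_nonneg ‖(x : E)‖))]

lemma mul_units_inv (h : IsResolvent A z R) {w : ℂ} (G : (E →L[ℂ] E)ˣ)
    (hG : (G : E →L[ℂ] E) = 1 + (w - z) • R) : IsResolvent A w (R * ↑G⁻¹) := by
  have hGx (x : E) : (G : E →L[ℂ] E) x = x + (w - z) • R x := by rw [hG]; rfl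
  have hcomm : Commute R ↑G⁻¹ := by
    refine Commute.units_inv_right (hG ▸ ?_)
    exact (Commute.one_right R).add_right ((Commute.refl R).smul_right _)
  have hleft (x : E) : (↑G⁻¹ : E →L[ℂ] E) ((G : E →L[ℂ] E) x) = x :=
    congrArg (· x) G.inv_mul
  have hright (x : E) : (G : E →L[ℂ] E) ((↑G⁻¹ : E →L[ℂ] E) x) = x :=
    congrArg (· x) G.mul_inv
  refine ⟨fun x => ?_, fun y => ⟨h.mem _, ?_⟩⟩
  · rw [hcomm.eq, mul_apply_eq_comp, map_sub, map_smul, h.apply_map]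
    conv_rhs => rw [← hleft x, hGx]
    congr 1
    module
  · have hy := hGx ((↑G⁻¹ : E →L[ℂ] E) y)
    rw [hright] at hy
    have hA := h.map_apply ((↑G⁻¹ : E →L[ℂ] E) y)
    simp only [mul_apply_eq_comp, hA]
    linear_combination (norm := module) -hy

end IsResolvent

lemma IsDissipative.ofReal_mem_resolventSet [CompleteSpace E] (hA : IsDissipative A) {r₀ r : ℝ}
    (hr₀ : 0 ≤ r₀) (h : (r₀ : ℂ) ∈ resolventSet A) (hr : 0 < r) : (r : ℂ) ∈ resolventSet A := by
  obtain ⟨R, hR⟩ := mem_resolventSet_iff.1 h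
  obtain ⟨G, hG⟩ := hR.isUnit_one_add_smul hA hr₀ hr
  exact mem_resolventSet_iff.2 ⟨_, hR.mul_units_inv G hG⟩

end Resolvent

section MaximalDissipative

variable {E : Type*} [NormedAddCommGroup E] [InnerProductSpace ℂ E] {A : E →ₗ.[ℂ] E}

/-- Maximal dissipativity, in the form of the range condition: `A` is dissipative and `1 - A` is
invertible. These are the operators to which the Lumer-Phillips theorem applies. -/
structure IsMaximalDissipative (A : E →ₗ.[ℂ] E) : Prop where
  isDissipative : IsDissipative A
  one_mem : 1 ∈ resolventSet A

lemma IsDissipative.isMaximalDissipative [CompleteSpace E] (hA : IsDissipative A)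
    (h : 0 ∈ resolventSet A) : IsMaximalDissipative A where
  isDissipative := hA
  one_mem := by simpa using hA.ofReal_mem_resolventSet le_rfl (by simpa using h) one_pos

namespace IsMaximalDissipative

lemma isResolvent_one (h : IsMaximalDissipative A) :
    IsResolvent A 1 (boundedResolvent A 1) :=
  isResolvent_boundedResolvent h.one_mem

lemma isResolvent_ofReal [CompleteSpace E] (h : IsMaximalDissipative A) {r : ℝ} (hr : 0 < r) :
    IsResolvent A r (boundedResolvent A r) :=
  isResolvent_boundedResolvent <|
    h.isDissipative.ofReal_mem_resolventSet zero_le_one (by simpa using h.one_mem) hr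

lemma mem_graph_of_forall_re_inner_nonpos (h : IsMaximalDissipative A) {x y : E}
    (hxy : ∀ w : A.domain, (inner ℂ (y - A w) (x - w)).re ≤ 0) : (x, y) ∈ A.graph := by
  let w : A.domain := ⟨_, h.isResolvent_one.mem (x - y)⟩
  have hAw : A w = w - (x - y) := by rw [h.isResolvent_one.map_apply, one_smul]
  have hyw : y - A w = x - w := by rw [hAw]; abel
  have hx : x = w := by
    have h0 := hxy w
    rw [hyw, re_inner_self_eq_norm_sq] at h0
    simpa [sub_eq_zero] using h0.antisymm (sq_nonneg _)
  have hy : y = A w := sub_eq_zero.1 (by rw [hyw, hx, sub_self])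
  exact (LinearPMap.mem_graph_iff _).2 ⟨w, hx.symm, hy.symm⟩

lemma dense_domain [CompleteSpace E] (h : IsMaximalDissipative A) :
    Dense (A.domain : Set E) := by
  rw [Submodule.dense_iff_topologicalClosure_eq_top, Submodule.topologicalClosure_eq_top_iff,
    Submodule.eq_bot_iff]
  intro x hx
  have horth : ∀ w : A.domain, inner ℂ x (w : E) = 0 := fun w =>
    inner_eq_zero_symm.1 (hx w w.2)
  have h0 : (0, x) ∈ A.graph := h.mem_graph_of_forall_re_inner_nonpos fun w => by
    simpa [inner_sub_left, horth w] using h.isDissipative w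
  exact LinearPMap.graph_fst_eq_zero_snd A h0 rfl

end IsMaximalDissipative

end MaximalDissipative

section Exponential

open NormedSpace (exp)

variable {E : Type*} [NormedAddCommGroup E] [NormedSpace ℂ E] [CompleteSpace E] {Y Z : E →L[ℂ] E}

lemma hasDerivAt_exp_smul_apply (Y : E →L[ℂ] E) (x : E) (t : ℝ) :
    HasDerivAt (fun s : ℝ => exp (s • Y) x) (exp (t • Y) (Y x)) t :=
  ((ContinuousLinearMap.apply ℂ E x).restrictScalars ℝ).hasFDerivAt.comp_hasDerivAt t
    (hasDerivAt_exp_smul_const Y t)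

lemma hasDerivAt_exp_smul_apply' (Y : E →L[ℂ] E) (x : E) (t : ℝ) :
    HasDerivAt (fun s : ℝ => exp (s • Y) x) (Y (exp (t • Y) x)) t :=
  ((ContinuousLinearMap.apply ℂ E x).restrictScalars ℝ).hasFDerivAt.comp_hasDerivAt t
    (hasDerivAt_exp_smul_const' Y t)

lemma exp_add_smul_apply (Y : E →L[ℂ] E) (s t : ℝ) (x : E) :
    exp ((s + t) • Y) x = exp (s • Y) (exp (t • Y) x) := by
  let +nondep : NormedAlgebra ℚ (E →L[ℂ] E) := .restrictScalars ℚ ℂ _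
  rw [add_smul, NormedSpace.exp_add_of_commute (((Commute.refl Y).smul_left s).smul_right t),
    mul_apply_eq_comp]

lemma integral_exp_smul_apply (Y : E →L[ℂ] E) (x : E) (t : ℝ) :
    ∫ s in 0..t, exp (s • Y) (Y x) = exp (t • Y) x - x := by
  have hc : Continuous fun s : ℝ => exp (s • Y) (Y x) :=
    continuous_iff_continuousAt.2 fun s => (hasDerivAt_exp_smul_apply Y (Y x) s).continuousAt
  rw [intervalIntegral.integral_eq_sub_of_hasDerivAt
    (fun s _ => hasDerivAt_exp_smul_apply Y x s) (hc.intervalIntegrable 0 t)]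
  simp

lemma lipschitzOnWith_exp_smul_apply (hY : ∀ t : ℝ, 0 ≤ t → ‖exp (t • Y)‖ ≤ 1) (x : E) :
    LipschitzOnWith ‖Y x‖₊ (fun t : ℝ => exp (t • Y) x) (Ici 0) :=
  (convex_Ici 0).lipschitzOnWith_of_nnnorm_hasDerivWithin_le
    (fun s _ => (hasDerivAt_exp_smul_apply Y x s).hasDerivWithinAt)
    fun s hs => ((exp (s • Y)).le_of_opNorm_le (hY s hs) (Y x)).trans_eq (one_mul _)

/-- Interpolate by `s ↦ exp (t Z) exp (s (Y - Z)) = exp (s Y) exp ((t - s) Z)`. -/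
lemma norm_exp_smul_sub_exp_smul_le (hYZ : Commute Y Z)
    (hY : ∀ t : ℝ, 0 ≤ t → ‖exp (t • Y)‖ ≤ 1) (hZ : ∀ t : ℝ, 0 ≤ t → ‖exp (t • Z)‖ ≤ 1) {t : ℝ}
    (ht : 0 ≤ t) (x : E) : ‖exp (t • Y) x - exp (t • Z) x‖ ≤ ‖Y x - Z x‖ * t := by
  let +nondep : NormedAlgebra ℚ (E →L[ℂ] E) := .restrictScalars ℚ ℂ _
  have hexp (s : ℝ) (y : E) :
      exp (t • Z) (exp (s • (Y - Z)) y) = exp (s • Y) (exp ((t - s) • Z) y) := by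
    rw [← mul_apply_eq_comp, ← mul_apply_eq_comp, ← NormedSpace.exp_add_of_commute
      (((hYZ.symm.sub_right (Commute.refl Z)).smul_left t).smul_right s),
      ← NormedSpace.exp_add_of_commute ((hYZ.smul_left s).smul_right (t - s))]
    congr 2
    module
  have hderiv (s : ℝ) : HasDerivAt (fun s : ℝ => exp (t • Z) (exp (s • (Y - Z)) x))
      (exp (t • Z) (exp (s • (Y - Z)) (Y x - Z x))) s :=
    ((exp (t • Z)).restrictScalars ℝ).hasFDerivAt.comp_hasDerivAt s
      (hasDerivAt_exp_smul_apply (Y - Z) x s)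
  have hbound : ∀ s ∈ Ico 0 t, ‖exp (t • Z) (exp (s • (Y - Z)) (Y x - Z x))‖ ≤ ‖Y x - Z x‖ := by
    intro s hs
    rw [hexp]
    calc ‖exp (s • Y) (exp ((t - s) • Z) (Y x - Z x))‖
        ≤ 1 * ‖exp ((t - s) • Z) (Y x - Z x)‖ := (exp (s • Y)).le_of_opNorm_le (hY s hs.1) _
      _ ≤ 1 * (1 * ‖Y x - Z x‖) := by
        gcongr
        exact ContinuousLinearMap.le_of_opNorm_le _ (hZ _ (sub_nonneg.2 hs.2.le)) _
      _ = ‖Y x - Z x‖ := by ring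
  have h := norm_image_sub_le_of_norm_deriv_le_segment'
    (fun s _ => (hderiv s).hasDerivWithinAt) hbound t ⟨ht, le_rfl⟩
  simpa [hexp t x] using h

end Exponential

lemma norm_exp_smul_le_one {E : Type*} [NormedAddCommGroup E] [InnerProductSpace ℂ E]
    [CompleteSpace E] {Y : E →L[ℂ] E} (hY : ∀ x, (inner ℂ (Y x) x).re ≤ 0) {t : ℝ}
    (ht : 0 ≤ t) : ‖NormedSpace.exp (t • Y)‖ ≤ 1 := by
  refine ContinuousLinearMap.opNorm_le_bound _ zero_le_one fun x => ?_
  have h := antitoneOn_norm_of_re_inner_deriv_nonpos (𝕜 := ℂ) (convex_Ici 0)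
    (fun s _ => (hasDerivAt_exp_smul_apply' Y x s).hasDerivWithinAt) (fun s _ => hY _)
    self_mem_Ici ht ht
  simpa using h

section Yosida

open NormedSpace (exp)

variable {E : Type*} [NormedAddCommGroup E] [InnerProductSpace ℂ E] {A : E →ₗ.[ℂ] E}

/-- The Yosida approximation `r² (r - A)⁻¹ - r = r A (r - A)⁻¹` of `A`, for `r > 0` large. -/
def yosida (A : E →ₗ.[ℂ] E) (r : ℝ) : E →L[ℂ] E :=
  (r : ℂ) • ((r : ℂ) • boundedResolvent A r - 1)

variable [CompleteSpace E] {r s : ℝ}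

namespace IsMaximalDissipative

lemma norm_smul_boundedResolvent_le (h : IsMaximalDissipative A) (hr : 0 < r) :
    ‖(r : ℂ) • boundedResolvent A r‖ ≤ 1 := by
  refine ContinuousLinearMap.opNorm_le_bound _ zero_le_one fun x => ?_
  simpa [norm_smul, abs_of_pos hr] using (h.isResolvent_ofReal hr).re_mul_norm_le h.1 x

lemma yosida_apply (h : IsMaximalDissipative A) (hr : 0 < r) (x : A.domain) :
    yosida A r x = ((r : ℂ) • boundedResolvent A r) (A x) := by
  rw [smul_apply, (h.isResolvent_ofReal hr).apply_map]
  rfl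

lemma norm_yosida_apply_le (h : IsMaximalDissipative A) (hr : 0 < r) (x : A.domain) :
    ‖yosida A r x‖ ≤ ‖A x‖ := by
  rw [h.yosida_apply hr]
  simpa using ContinuousLinearMap.le_of_opNorm_le _ (h.norm_smul_boundedResolvent_le hr) (A x)

lemma re_inner_yosida_nonpos (h : IsMaximalDissipative A) (hr : 0 < r) (x : E) :
    (inner ℂ (yosida A r x) x).re ≤ 0 := by
  have hle : (inner ℂ (((r : ℂ) • boundedResolvent A r) x) x).re ≤ ‖x‖ ^ 2 :=
    calc (inner ℂ (((r : ℂ) • boundedResolvent A r) x) x).re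
        ≤ ‖((r : ℂ) • boundedResolvent A r) x‖ * ‖x‖ := re_inner_le_norm (𝕜 := ℂ) _ _
      _ ≤ 1 * ‖x‖ * ‖x‖ := by
        gcongr
        exact ContinuousLinearMap.le_of_opNorm_le _ (h.norm_smul_boundedResolvent_le hr) x
      _ = ‖x‖ ^ 2 := by ring
  rw [yosida, smul_apply, sub_apply, one_apply_eq_self, inner_smul_left, inner_sub_left,
    Complex.conj_ofReal, Complex.re_ofReal_mul, Complex.sub_re, re_inner_self_eq_norm_sq]
  exact mul_nonpos_of_nonneg_of_nonpos hr.le (sub_nonpos.2 hle)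

lemma commute_yosida (h : IsMaximalDissipative A) (hr : 0 < r) (hs : 0 < s) :
    Commute (yosida A r) (yosida A s) := by
  have hR := (h.isResolvent_ofReal hr).commute (h.isResolvent_ofReal hs)
  exact (((((hR.smul_left _).smul_right _).sub_left (Commute.one_left _)).sub_right
    (Commute.one_right _)).smul_left _).smul_right _

lemma norm_exp_yosida_le_one (h : IsMaximalDissipative A) (hr : 0 < r) {t : ℝ} (ht : 0 ≤ t) :
    ‖exp (t • yosida A r)‖ ≤ 1 :=
  norm_exp_smul_le_one (h.re_inner_yosida_nonpos hr) ht

lemma tendsto_smul_boundedResolvent (h : IsMaximalDissipative A) (x : E) :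
    Tendsto (fun n : ℕ => (((n + 1 : ℝ) : ℂ) • boundedResolvent A (n + 1 : ℝ)) x) atTop
      (𝓝 x) := by
  refine tendsto_apply_of_dense (C := 1) (G := .id ℂ E)
    (fun n => h.norm_smul_boundedResolvent_le n.cast_add_one_pos) h.dense_domain (fun x hx => ?_) x
  rw [tendsto_iff_norm_sub_tendsto_zero]
  refine squeeze_zero (fun _ => norm_nonneg _) (fun n => ?_)
    (by simpa using tendsto_one_div_add_atTop_nhds_zero_nat.mul_const ‖A ⟨x, hx⟩‖)
  have hR := h.isResolvent_ofReal (n.cast_add_one_pos (α := ℝ))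
  rw [smul_apply, ContinuousLinearMap.id_apply, ← hR.apply_map ⟨x, hx⟩, inv_mul_eq_div,
    le_div_iff₀' (by positivity)]
  exact hR.re_mul_norm_le h.1 _

lemma tendsto_yosida (h : IsMaximalDissipative A) (x : A.domain) :
    Tendsto (fun n : ℕ => yosida A (n + 1) x) atTop (𝓝 (A x)) :=
  (h.tendsto_smul_boundedResolvent (A x)).congr fun n =>
    (h.yosida_apply n.cast_add_one_pos x).symm

lemma cauchySeq_exp_yosida (h : IsMaximalDissipative A) {t : ℝ} (ht : 0 ≤ t) (x : E) :
    CauchySeq fun n : ℕ => exp (t • yosida A (n + 1)) x := by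
  have hpos (n : ℕ) : (0 : ℝ) < n + 1 := n.cast_add_one_pos
  refine cauchySeq_apply_of_dense (C := 1) (fun n => h.norm_exp_yosida_le_one (hpos n) ht)
    h.dense_domain (fun x hx => ?_) x
  have hY := cauchySeq_iff_tendsto_dist_atTop_0.1 (h.tendsto_yosida ⟨x, hx⟩).cauchySeq
  refine cauchySeq_iff_tendsto_dist_atTop_0.2 <| squeeze_zero (fun _ => dist_nonneg)
    (fun p => ?_) (by simpa using hY.mul_const t)
  simp only [dist_eq_norm]
  exact norm_exp_smul_sub_exp_smul_le (h.commute_yosida (hpos _) (hpos _))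
    (fun s hs => h.norm_exp_yosida_le_one (hpos _) hs)
    (fun s hs => h.norm_exp_yosida_le_one (hpos _) hs) ht x

end IsMaximalDissipative

end Yosida

section Semigroup

open NormedSpace (exp)

variable {E : Type*} [NormedAddCommGroup E] [InnerProductSpace ℂ E] [CompleteSpace E]
  {A : E →ₗ.[ℂ] E}

namespace IsMaximalDissipative

lemma exists_tendsto_exp_yosida (h : IsMaximalDissipative A) (t : ℝ≥0) :
    ∃ G : E →L[ℂ] E, ∀ x, Tendsto (fun n : ℕ => exp ((t : ℝ) • yosida A (n + 1)) x) atTop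
      (𝓝 (G x)) :=
  exists_tendsto_apply_of_cauchySeq (h.cauchySeq_exp_yosida t.2)

/-- The contraction semigroup generated by a maximal dissipative operator, as the limit of the
semigroups generated by its Yosida approximations. -/
def semigroup (h : IsMaximalDissipative A) (t : ℝ≥0) : E →L[ℂ] E :=
  (h.exists_tendsto_exp_yosida t).choose

lemma tendsto_exp_yosida (h : IsMaximalDissipative A) (t : ℝ≥0) (x : E) :
    Tendsto (fun n : ℕ => exp ((t : ℝ) • yosida A (n + 1)) x) atTop (𝓝 (h.semigroup t x)) :=
  (h.exists_tendsto_exp_yosida t).choose_spec x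

lemma nnnorm_exp_yosida_le_one (h : IsMaximalDissipative A) (t : ℝ≥0) (n : ℕ) :
    ‖exp ((t : ℝ) • yosida A (n + 1))‖₊ ≤ 1 :=
  h.norm_exp_yosida_le_one n.cast_add_one_pos t.2

lemma norm_semigroup_le_one (h : IsMaximalDissipative A) (t : ℝ≥0) : ‖h.semigroup t‖ ≤ 1 :=
  ContinuousLinearMap.opNorm_le_bound _ zero_le_one fun x =>
    le_of_tendsto (h.tendsto_exp_yosida t x).norm <| .of_forall fun n =>
      ContinuousLinearMap.le_of_opNorm_le _ (h.nnnorm_exp_yosida_le_one t n) x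

lemma semigroup_zero (h : IsMaximalDissipative A) : h.semigroup 0 = .id ℂ E := by
  ext x
  refine tendsto_nhds_unique (h.tendsto_exp_yosida 0 x) ?_
  simp [NormedSpace.exp_zero]

lemma semigroup_add (h : IsMaximalDissipative A) (s t : ℝ≥0) :
    h.semigroup (s + t) = (h.semigroup s).comp (h.semigroup t) := by
  ext x
  refine tendsto_nhds_unique (h.tendsto_exp_yosida (s + t) x) ?_
  simp only [NNReal.coe_add, exp_add_smul_apply]
  exact tendsto_apply_of_tendsto (h.nnnorm_exp_yosida_le_one s) (h.tendsto_exp_yosida t x)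
    (h.tendsto_exp_yosida s _)

lemma lipschitzWith_semigroup_apply (h : IsMaximalDissipative A) (x : A.domain) :
    LipschitzWith ‖A x‖₊ fun t => h.semigroup t x := fun s t => by
  refine le_of_tendsto ((h.tendsto_exp_yosida s x).edist (h.tendsto_exp_yosida t x))
    (.of_forall fun n => ?_)
  have hn : (0 : ℝ) < n + 1 := n.cast_add_one_pos
  have hle : ‖yosida A (n + 1) x‖₊ ≤ ‖A x‖₊ := h.norm_yosida_apply_le hn x
  have hlip :=
    (lipschitzOnWith_exp_smul_apply (fun _ => h.norm_exp_yosida_le_one hn) (x : E)).weaken hle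
  exact hlip s.2 t.2

lemma continuous_semigroup_apply (h : IsMaximalDissipative A) (x : E) :
    Continuous fun t => h.semigroup t x :=
  continuous_iff_continuousAt.2 fun _ =>
    tendsto_apply_of_dense (C := 1) h.norm_semigroup_le_one h.dense_domain
      (fun x hx => (h.lipschitzWith_semigroup_apply ⟨x, hx⟩).continuous.continuousAt) x

lemma isC0ContractionSemigroup (h : IsMaximalDissipative A) :
    IsC0ContractionSemigroup h.semigroup where
  zero := h.semigroup_zero
  add := h.semigroup_add
  tendsto_zero x := (h.continuous_semigroup_apply x).tendsto' 0 x (by simp [h.semigroup_zero])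
  contraction := h.norm_semigroup_le_one

lemma continuous_semigroup_toNNReal (h : IsMaximalDissipative A) (x : E) :
    Continuous fun t : ℝ => h.semigroup t.toNNReal x :=
  (h.continuous_semigroup_apply x).comp continuous_real_toNNReal

/-- Pass to the limit in the same identity for the Yosida approximations. -/
lemma integral_semigroup_apply (h : IsMaximalDissipative A) (x : A.domain) {t : ℝ} (ht : 0 ≤ t) :
    ∫ s in 0..t, h.semigroup s.toNNReal (A x) = h.semigroup t.toNNReal x - x := by
  have hpos (n : ℕ) : (0 : ℝ) < n + 1 := n.cast_add_one_pos
  have hderiv : Tendsto (fun n : ℕ => ∫ s in 0..t, exp (s • yosida A (n + 1))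
      (yosida A (n + 1) x)) atTop (𝓝 (∫ s in 0..t, h.semigroup s.toNNReal (A x))) := by
    refine intervalIntegral.tendsto_integral_filter_of_dominated_convergence (fun _ => ‖A x‖)
      (.of_forall fun n => ?_) (.of_forall fun n => .of_forall fun s hs => ?_)
      intervalIntegrable_const (.of_forall fun s hs => ?_)
    · exact (continuous_iff_continuousAt.2 fun s =>
        (hasDerivAt_exp_smul_apply _ _ s).continuousAt).aestronglyMeasurable
    · rw [uIoc_of_le ht] at hs
      exact (ContinuousLinearMap.le_of_opNorm_le _ (h.norm_exp_yosida_le_one (hpos n) hs.1.le)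
        _).trans (by simpa using h.norm_yosida_apply_le (hpos n) x)
    · rw [uIoc_of_le ht] at hs
      have hlim := tendsto_apply_of_tendsto (h.nnnorm_exp_yosida_le_one s.toNNReal)
        (h.tendsto_yosida x) (h.tendsto_exp_yosida s.toNNReal (A x))
      rwa [Real.coe_toNNReal s hs.1.le] at hlim
  have hdiff := (h.tendsto_exp_yosida t.toNNReal x).sub_const (x : E)
  rw [Real.coe_toNNReal t ht] at hdiff
  exact tendsto_nhds_unique hderiv (by simpa only [integral_exp_smul_apply] using hdiff)

lemma hasDerivWithinAt_semigroup (h : IsMaximalDissipative A) {x y : E} (hxy : (x, y) ∈ A.graph)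
    {t : ℝ} (ht : t ∈ Ici (0 : ℝ)) :
    HasDerivWithinAt (fun s : ℝ => h.semigroup s.toNNReal x) (h.semigroup t.toNNReal y)
      (Ici 0) t := by
  obtain ⟨x, rfl, rfl⟩ := (LinearPMap.mem_graph_iff _).1 hxy
  have hint : ∀ s ∈ Ici (0 : ℝ), h.semigroup s.toNNReal x =
      x + ∫ r in 0..s, h.semigroup r.toNNReal (A x) := fun s hs => by
    rw [h.integral_semigroup_apply x hs, add_sub_cancel]
  exact ((((h.continuous_semigroup_toNNReal (A x)).integral_hasStrictDerivAt 0
    t).hasDerivAt.const_add (x : E)).hasDerivWithinAt).congr hint (hint t ht)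

lemma tendsto_inv_smul_semigroup_sub (h : IsMaximalDissipative A) {x y : E}
    (hxy : (x, y) ∈ A.graph) :
    Tendsto (fun t : ℝ≥0 => (t : ℝ)⁻¹ • (h.semigroup t x - x)) (𝓝[>] 0) (𝓝 y) := by
  have hderiv := (h.hasDerivWithinAt_semigroup hxy self_mem_Ici).Ioi_of_Ici
  rw [hasDerivWithinAt_iff_tendsto_slope' self_notMem_Ioi] at hderiv
  have hcoe : Tendsto ((↑) : ℝ≥0 → ℝ) (𝓝[>] 0) (𝓝[>] 0) :=
    NNReal.continuous_coe.continuousWithinAt.tendsto_nhdsWithin fun _ ht => ht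
  simpa [slope_def_module, Function.comp_def, h.semigroup_zero] using hderiv.comp hcoe

lemma re_inner_inv_smul_semigroup_sub_nonpos (h : IsMaximalDissipative A) (t : ℝ≥0) (x : E) :
    (inner ℂ ((t : ℝ)⁻¹ • (h.semigroup t x - x)) x).re ≤ 0 := by
  have hle : (inner ℂ (h.semigroup t x) x).re ≤ ‖x‖ ^ 2 :=
    calc (inner ℂ (h.semigroup t x) x).re
        ≤ ‖h.semigroup t x‖ * ‖x‖ := re_inner_le_norm (𝕜 := ℂ) _ _
      _ ≤ 1 * ‖x‖ * ‖x‖ := by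
        gcongr
        exact ContinuousLinearMap.le_of_opNorm_le _ (h.norm_semigroup_le_one t) x
      _ = ‖x‖ ^ 2 := by ring
  rw [← Complex.coe_smul, inner_smul_left, Complex.conj_ofReal, Complex.re_ofReal_mul,
    inner_sub_left, Complex.sub_re, re_inner_self_eq_norm_sq]
  exact mul_nonpos_of_nonneg_of_nonpos (by positivity) (sub_nonpos.2 hle)

/-- The generator of the semigroup is a dissipative extension of `A`, hence equal to `A`. -/
lemma isGenerator_semigroup (h : IsMaximalDissipative A) : IsGenerator A h.semigroup := by
  refine fun x y => ⟨?_, fun hxy => ?_⟩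
  · rintro ⟨hx, rfl⟩
    exact h.tendsto_inv_smul_semigroup_sub (A.mem_graph ⟨x, hx⟩)
  have hgraph : (x, y) ∈ A.graph := h.mem_graph_of_forall_re_inner_nonpos fun w => by
    have hdiff : Tendsto (fun t : ℝ≥0 => (t : ℝ)⁻¹ • (h.semigroup t (x - w) - (x - w)))
        (𝓝[>] 0) (𝓝 (y - A w)) :=
      (hxy.sub (h.tendsto_inv_smul_semigroup_sub (A.mem_graph w))).congr fun t => by
        rw [map_sub]
        module
    exact le_of_tendsto ((Complex.continuous_re.tendsto _).comp
      (hdiff.inner (𝕜 := ℂ) tendsto_const_nhds)) <|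
      .of_forall fun t => h.re_inner_inv_smul_semigroup_sub_nonpos t _
  obtain ⟨w, rfl, rfl⟩ := (LinearPMap.mem_graph_iff _).1 hgraph
  exact ⟨w.2, rfl⟩

end IsMaximalDissipative

end Semigroup

section Powers

variable {E : Type*} [NormedAddCommGroup E] [InnerProductSpace ℂ E] {A S T : E →ₗ.[ℂ] E}
  {n : ℕ} {x y : E}

lemma mem_graph_opComp :
    (x, y) ∈ (opComp S T).graph ↔ ∃ z, (x, z) ∈ T.graph ∧ (z, y) ∈ S.graph := by
  constructor
  · intro h
    obtain ⟨⟨x, hx, hTx⟩, rfl, rfl⟩ := (LinearPMap.mem_graph_iff _).1 h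
    exact ⟨_, T.mem_graph ⟨x, hx⟩, S.mem_graph ⟨_, hTx⟩⟩
  · rintro ⟨z, hxz, hzy⟩
    obtain ⟨x, rfl, rfl⟩ := (LinearPMap.mem_graph_iff _).1 hxz
    have hTx : T x ∈ S.domain := LinearPMap.mem_domain_of_mem_graph hzy
    rw [(LinearPMap.image_iff hTx).2 hzy]
    exact (opComp S T).mem_graph ⟨x, x.2, hTx⟩

lemma mem_graph_opPow_zero : (x, y) ∈ (opPow A 0).graph ↔ x = y := by
  simp [opPow, LinearPMap.mem_graph_iff]

lemma mem_graph_opPow_succ : (x, y) ∈ (opPow A (n + 1)).graph ↔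
    ∃ z, (x, z) ∈ A.graph ∧ (z, y) ∈ (opPow A n).graph :=
  mem_graph_opComp

lemma mem_graph_opPow_succ' : (x, y) ∈ (opPow A (n + 1)).graph ↔
    ∃ z, (x, z) ∈ (opPow A n).graph ∧ (z, y) ∈ A.graph := by
  induction n generalizing x y with
  | zero =>
    rw [mem_graph_opPow_succ]
    simp only [mem_graph_opPow_zero, exists_eq_right, exists_eq_left']
  | succ n ih =>
    rw [mem_graph_opPow_succ]
    constructor
    · rintro ⟨z, hxz, hzy⟩
      obtain ⟨w, hzw, hwy⟩ := ih.1 hzy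
      exact ⟨w, mem_graph_opPow_succ.2 ⟨z, hxz, hzw⟩, hwy⟩
    · rintro ⟨w, hxw, hwy⟩
      obtain ⟨z, hxz, hzw⟩ := mem_graph_opPow_succ.1 hxw
      exact ⟨z, hxz, ih.2 ⟨w, hzw, hwy⟩⟩

lemma opPow_domain_antitone : Antitone fun n => (opPow A n).domain :=
  antitone_nat_of_succ_le fun n x hx => by
    obtain ⟨z, hxz, -⟩ := mem_graph_opPow_succ'.1 (LinearPMap.mem_graph _ ⟨x, hx⟩)
    exact LinearPMap.mem_domain_of_mem_graph hxz

end Powers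

section Invariance

variable {E : Type*} [NormedAddCommGroup E] [InnerProductSpace ℂ E] {A : E →ₗ.[ℂ] E}
  {S : ℝ≥0 → E →L[ℂ] E} {x y : E}

lemma IsGenerator.mem_graph_iff (hA : IsGenerator A S) : (x, y) ∈ A.graph ↔
    Tendsto (fun t : ℝ≥0 => (t : ℝ)⁻¹ • (S t x - x)) (𝓝[>] 0) (𝓝 y) := by
  rw [← hA x y]
  refine ⟨fun hxy => ?_, fun ⟨hx, hxy⟩ => (LinearPMap.image_iff hx).1 hxy.symm⟩
  have hx := LinearPMap.mem_domain_of_mem_graph hxy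
  exact ⟨hx, ((LinearPMap.image_iff hx).2 hxy).symm⟩

lemma IsC0ContractionSemigroup.apply_comm (hS : IsC0ContractionSemigroup S) (s t : ℝ≥0) (x : E) :
    S s (S t x) = S t (S s x) := by
  rw [← ContinuousLinearMap.comp_apply, ← ContinuousLinearMap.comp_apply, ← hS.add, ← hS.add,
    add_comm]

lemma IsGenerator.apply_mem_graph (hA : IsGenerator A S) (hS : IsC0ContractionSemigroup S)
    (t : ℝ≥0) (hxy : (x, y) ∈ A.graph) : (S t x, S t y) ∈ A.graph := by
  rw [hA.mem_graph_iff] at hxy ⊢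
  refine (((S t).continuous.tendsto y).comp hxy).congr fun s => ?_
  rw [Function.comp_apply, map_real_smul (S t) (S t).continuous, map_sub, hS.apply_comm s t]

lemma IsGenerator.apply_mem_graph_opPow (hA : IsGenerator A S) (hS : IsC0ContractionSemigroup S)
    (t : ℝ≥0) {n : ℕ} (hxy : (x, y) ∈ (opPow A n).graph) :
    (S t x, S t y) ∈ (opPow A n).graph := by
  induction n generalizing x with
  | zero => rw [mem_graph_opPow_zero.1 hxy, mem_graph_opPow_zero]
  | succ n ih =>
    obtain ⟨z, hxz, hzy⟩ := mem_graph_opPow_succ.1 hxy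
    exact mem_graph_opPow_succ.2 ⟨S t z, hA.apply_mem_graph hS t hxz, ih hzy⟩

end Invariance

section CauchyProblem

variable {E : Type*} [NormedAddCommGroup E] [InnerProductSpace ℂ E] [CompleteSpace E]
  {A : E →ₗ.[ℂ] E} {x y V V' : E}

lemma inner_eq_inner_of_mem_graph (hA : Dense (A.domain : Set E)) (hV : (V, V') ∈ A†.graph)
    (hxy : (x, y) ∈ A.graph) : inner ℂ V' x = inner ℂ V y := by
  obtain ⟨V, rfl, rfl⟩ := (LinearPMap.mem_graph_iff _).1 hV
  obtain ⟨x, rfl, rfl⟩ := (LinearPMap.mem_graph_iff _).1 hxy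
  exact LinearPMap.adjoint_isFormalAdjoint hA V x

lemma IsResolvent.adjoint_mem_graph (hA : Dense (A.domain : Set E)) {z : ℂ} {R : E →L[ℂ] E}
    (h : IsResolvent A z R) (V : E) :
    (R.adjoint V, starRingEnd ℂ z • R.adjoint V - V) ∈ A†.graph := by
  have hadj (x : A.domain) : inner ℂ (starRingEnd ℂ z • R.adjoint V - V) (x : E) =
      inner ℂ (R.adjoint V) (A x) := by
    rw [ContinuousLinearMap.adjoint_inner_left, h.apply_map, inner_sub_left, inner_smul_left,
      ContinuousLinearMap.adjoint_inner_left, inner_sub_right, inner_smul_right,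
      Complex.conj_conj]
  have hmem := LinearPMap.mem_adjoint_domain_of_exists (T := A) _ ⟨_, hadj⟩
  exact (LinearPMap.image_iff hmem).1 (LinearPMap.adjoint_apply_eq hA ⟨_, hmem⟩ hadj).symm

lemma IsWeakSolution.hasDerivWithinAt_inner {U : ℝ → E} (hU : IsWeakSolution A x U)
    (hV : (V, V') ∈ A†.graph) {t : ℝ} (ht : t ∈ Ici (0 : ℝ)) :
    HasDerivWithinAt (fun s => inner ℂ V (U s)) (inner ℂ V' (U t)) (Ici 0) t := by
  obtain ⟨V, rfl, rfl⟩ := (LinearPMap.mem_graph_iff _).1 hV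
  exact hU.weak V t ht

namespace IsMaximalDissipative

/-- If `x = y - A y` then `⟨V, S(t) x⟩ = ⟨V - A† V, S(t) y⟩`, and the orbit of `y` is
differentiable. -/
lemma isWeakSolution_semigroup (h : IsMaximalDissipative A) (x : E) :
    IsWeakSolution A x fun t => h.semigroup t.toNNReal x where
  continuousOn := (h.continuous_semigroup_toNNReal x).continuousOn
  initial := by simp [h.semigroup_zero]
  weak V t ht := by
    obtain ⟨hy, hxy⟩ := h.isResolvent_one.right_inv x
    set y : A.domain := ⟨boundedResolvent A 1 x, hy⟩
    rw [one_smul] at hxy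
    have hsub (s : ℝ≥0) : h.semigroup s x = h.semigroup s y - h.semigroup s (A y) := by
      rw [← map_sub]
      exact congrArg _ hxy.symm
    have hadj (s : ℝ≥0) :
        inner ℂ (A† V) (h.semigroup s y) = inner ℂ (V : E) (h.semigroup s (A y)) :=
      inner_eq_inner_of_mem_graph h.dense_domain (A†.mem_graph V) <|
        h.isGenerator_semigroup.apply_mem_graph h.isC0ContractionSemigroup s (A.mem_graph y)
    have hinner (s : ℝ≥0) : inner ℂ (V : E) (h.semigroup s x) =
        inner ℂ (V - A† V) (h.semigroup s y) := by
      rw [hsub, inner_sub_right, inner_sub_left, hadj]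
    have hinner' (s : ℝ≥0) : inner ℂ (V - A† V) (h.semigroup s (A y)) =
        inner ℂ (A† V) (h.semigroup s x) := by
      rw [hsub, inner_sub_right, inner_sub_left, hadj]
    have hderiv := ((innerSL ℂ (V - A† V)).restrictScalars ℝ).hasFDerivAt.comp_hasDerivWithinAt t
      (h.hasDerivWithinAt_semigroup (A.mem_graph y) ht)
    exact (hderiv.congr_deriv (hinner' _)).congr (fun _ _ => hinner _) (hinner _)

/-- Apply the resolvent `(1 - A)⁻¹` to the difference of two solutions: this yields a classical
solution, whose norm is nonincreasing. -/
lemma eqOn_of_isWeakSolution (h : IsMaximalDissipative A) {x : E} {U W : ℝ → E}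
    (hU : IsWeakSolution A x U) (hW : IsWeakSolution A x W) : EqOn W U (Ici 0) := by
  set R := boundedResolvent A 1
  have hR : IsResolvent A 1 R := h.isResolvent_one
  have hderiv : ∀ t ∈ Ici (0 : ℝ), HasDerivWithinAt (fun t => R (W t - U t))
      (R (W t - U t) - (W t - U t)) (Ici 0) t := by
    have hcont : ContinuousOn (fun t => W t - U t) (Ici 0) := hW.continuousOn.sub hU.continuousOn
    refine hasDerivWithinAt_of_inner (𝕜 := ℂ)
      ((R.continuous.comp_continuousOn hcont).sub hcont) fun V t ht => ?_
    have hV := hR.adjoint_mem_graph h.dense_domain V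
    have hVW := (hW.hasDerivWithinAt_inner hV ht).sub (hU.hasDerivWithinAt_inner hV ht)
    simpa only [map_one, one_smul, Pi.sub_def, inner_sub_right, inner_sub_left, map_sub,
      ContinuousLinearMap.adjoint_inner_left, sub_sub_sub_comm] using hVW
  have hanti := antitoneOn_norm_of_re_inner_deriv_nonpos (𝕜 := ℂ) (convex_Ici 0) hderiv
    fun t _ => by
      have hdiss := h.isDissipative ⟨R (W t - U t), hR.mem _⟩
      rwa [hR.map_apply, one_smul] at hdiss
  intro t ht
  have hle : ‖R (W t - U t)‖ ≤ ‖R (W 0 - U 0)‖ := hanti self_mem_Ici ht ht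
  rw [hW.initial, hU.initial, sub_self, map_zero, norm_zero, norm_le_zero_iff, ← map_zero R] at hle
  exact sub_eq_zero.1 (hR.injective hle)

end IsMaximalDissipative

end CauchyProblem

section Regularity

variable {E : Type*} [NormedAddCommGroup E] [InnerProductSpace ℂ E] [CompleteSpace E]
  {A : E →ₗ.[ℂ] E} {n m : ℕ} {x y x' y' : E}

namespace IsMaximalDissipative

/-- An orbit of the semigroup in the domain of `Aⁿ`, as a curve in the graph of `Aⁿ`. -/
def graphOrbit (h : IsMaximalDissipative A) (hxy : (x, y) ∈ (opPow A n).graph) (t : ℝ) :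
    (opPow A n).graph :=
  ⟨(h.semigroup t.toNNReal x, h.semigroup t.toNNReal y),
    h.isGenerator_semigroup.apply_mem_graph_opPow h.isC0ContractionSemigroup _ hxy⟩

lemma hasDerivWithinAt_graphOrbit (h : IsMaximalDissipative A)
    (hxy : (x, y) ∈ (opPow A n).graph) (hxy' : (x', y') ∈ (opPow A n).graph)
    (hx : (x, x') ∈ A.graph) (hy : (y, y') ∈ A.graph) {t : ℝ} (ht : t ∈ Ici (0 : ℝ)) :
    HasDerivWithinAt (h.graphOrbit hxy) (h.graphOrbit hxy' t) (Ici 0) t := by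
  rw [hasDerivWithinAt_iff_tendsto_slope, tendsto_subtype_rng]
  exact hasDerivWithinAt_iff_tendsto_slope.1
    ((h.hasDerivWithinAt_semigroup hx ht).prodMk (h.hasDerivWithinAt_semigroup hy ht))

lemma contDiffOn_graphOrbit (h : IsMaximalDissipative A) (hxy : (x, y) ∈ (opPow A n).graph)
    (hx : x ∈ (opPow A (n + m)).domain) : ContDiffOn ℝ m (h.graphOrbit hxy) (Ici 0) := by
  induction m generalizing x y with
  | zero =>
    exact contDiffOn_zero.2 (((h.continuous_semigroup_toNNReal x).prodMk
      (h.continuous_semigroup_toNNReal y)).subtype_mk _).continuousOn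
  | succ m ih =>
    obtain ⟨x', hxx', hx'⟩ := mem_graph_opPow_succ.1 (LinearPMap.mem_graph _ ⟨x, hx⟩)
    have hx_succ : x ∈ (opPow A (n + 1)).domain :=
      opPow_domain_antitone (by omega : n + 1 ≤ n + (m + 1)) hx
    obtain ⟨y₁, hxy₁, hy₁⟩ := mem_graph_opPow_succ'.1 (LinearPMap.mem_graph _ ⟨x, hx_succ⟩)
    obtain ⟨x₁, hxx₁, hxy'⟩ := mem_graph_opPow_succ.1 (LinearPMap.mem_graph _ ⟨x, hx_succ⟩)
    obtain rfl := LinearPMap.mem_graph_snd_inj _ hxy hxy₁ rfl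
    obtain rfl := LinearPMap.mem_graph_snd_inj _ hxx' hxx₁ rfl
    have hderiv := fun t ht => h.hasDerivWithinAt_graphOrbit hxy hxy' hxx' hy₁ (t := t) ht
    have hunique := uniqueDiffOn_Ici (0 : ℝ)
    rw [Nat.cast_add_one, contDiffOn_succ_iff_derivWithin hunique]
    refine ⟨fun t ht => (hderiv t ht).differentiableWithinAt, by simp, ?_⟩
    exact (ih hxy' (LinearPMap.mem_domain_of_mem_graph hx')).congr fun t ht =>
      (hderiv t ht).derivWithin (hunique t ht)

lemma contDiffInDomain_semigroup (h : IsMaximalDissipative A) {k j : ℕ} (hjk : j ≤ k)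
    (hx : x ∈ (opPow A k).domain) :
    ContDiffInDomain (opPow A j) (k - j) fun t => h.semigroup t.toNNReal x := by
  have hgraph := LinearPMap.mem_graph (opPow A j) ⟨x, opPow_domain_antitone hjk hx⟩
  exact ⟨h.graphOrbit hgraph, h.contDiffOn_graphOrbit hgraph (by rwa [Nat.add_sub_cancel' hjk]),
    fun _ _ => rfl⟩

end IsMaximalDissipative

end Regularity

section Energy

variable {E : Type*} [NormedAddCommGroup E] [InnerProductSpace ℂ E]

/-- With `P = A^{φ-1}`, `p = A^{1/2} u`, `q = A^{1/2} v`, `r = A^{1/2} w`, `k = A^{1/2} θ`, the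
left-hand side is `Re ⟨𝔹 U, U⟩`. The two coupling terms cancel because `P` is symmetric. -/
lemma energy_identity {P : E →ₗ[ℂ] E} (hP : P.IsSymmetric) (a α β η : ℝ) (p q r k : E) :
    (((a ^ 2 * α * (β - α) : ℝ) : ℂ) * inner ℂ r q
        + ((a ^ 2 : ℝ) : ℂ) * inner ℂ (q + (α : ℂ) • r) (p + (α : ℂ) • q)
        - inner ℂ (((a ^ 2 : ℝ) : ℂ) • p + ((a ^ 2 * β : ℝ) : ℂ) • q - (η : ℂ) • P k)
          (q + (α : ℂ) • r)
        - inner ℂ ((η : ℂ) • P (q + (α : ℂ) • r) + k) k).re =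
      -(a ^ 2 * (β - α) * ‖q‖ ^ 2) - ‖k‖ ^ 2 := by
  have hsymm (x y : E) : (inner ℂ x y).re = (inner ℂ y x).re := inner_re_symm (𝕜 := ℂ) x y
  have hcoupling :
      (inner ℂ (P k) (q + (α : ℂ) • r)).re = (inner ℂ (P (q + (α : ℂ) • r)) k).re := by
    rw [hP, hsymm]
  simp only [inner_add_left (𝕜 := ℂ), inner_sub_left, inner_smul_left, Complex.conj_ofReal,
    Complex.add_re, Complex.sub_re, Complex.re_ofReal_mul, hcoupling]
  simp only [inner_add_right, inner_smul_right, Complex.add_re, Complex.re_ofReal_mul,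
    re_inner_self_eq_norm_sq, hsymm q r, hsymm q p, hsymm r p]
  ring

end Energy

namespace System

variable {H : Type*} [NormedAddCommGroup H] [InnerProductSpace ℂ H] [CompleteSpace H]
variable (D : System H)

lemma isSymmetric_negPow (s : ℝ) : (negPow D.A s : H →ₗ[ℂ] H).IsSymmetric :=
  (IsSelfAdjoint.of_nonneg CFC.rpow_nonneg).isSymmetric

lemma commute_negPow (s t : ℝ) : Commute (negPow D.A s) (negPow D.A t) :=
  cfc_commute_cfc _ _ _

lemma negPow_half_powφ (x : H) :
    negPow D.A (1 / 2) (D.powφ x) = D.powφ (negPow D.A (1 / 2) x) :=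
  congrArg (· x) (D.commute_negPow (1 / 2) (1 - D.φ)).eq

lemma sqrtA_eq_iff {x : D.sqrtA.domain} {y : H} :
    D.sqrtA x = y ↔ negPow D.A (1 / 2) y = x := by
  rw [← D.negPow_sqrtA x, D.negPow_half_injective.eq_iff, eq_comm]

lemma powφ_mem_sqrtA_domain (x : D.sqrtA.domain) : D.powφ x ∈ D.sqrtA.domain := by
  rw [← D.negPow_sqrtA x, ← negPow_half_powφ]
  exact D.negPow_half_mem _

lemma negPow_half_A (x : D.A.domain) :
    negPow D.A (1 / 2) (negPow D.A (1 / 2) (D.A x)) = x := by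
  rw [D.negPow_half_sq, D.inv_spec.left_inv]

lemma A_domain_le_sqrtA_domain : D.A.domain ≤ D.sqrtA.domain := fun x hx => by
  have hmem := D.negPow_half_mem (negPow D.A (1 / 2) (D.A ⟨x, hx⟩))
  rwa [negPow_half_A] at hmem

lemma inner_A_left (x : D.A.domain) (y : D.sqrtA.domain) :
    inner ℂ (D.A x) (y : H) =
      inner ℂ (D.sqrtA ⟨x, D.A_domain_le_sqrtA_domain x.2⟩) (D.sqrtA y) := by
  rw [D.sqrtA_eq_iff.2 (D.negPow_half_A x)]
  nth_rewrite 1 [← D.negPow_sqrtA y]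
  exact (D.isSymmetric_negPow _ _ _).symm

section Dissipative

variable (U : D.𝔹.domain)

lemma w_mem : D.w U ∈ D.sqrtA.domain := U.2.1.1

lemma first_mem : D.first U ∈ D.A.domain := U.2.1.2

lemma second_mem : D.second U ∈ D.A.domain := U.2.2

lemma θ_mem : D.θ U ∈ D.sqrtA.domain := by
  have hθ : D.θ U = D.second U - ((D.η : ℂ) • D.powφ (D.v U : H)
      + ((D.α * D.η : ℝ) : ℂ) • D.powφ (D.w U)) := eq_sub_of_add_eq' rfl
  rw [hθ]
  exact D.sqrtA.domain.sub_mem (D.A_domain_le_sqrtA_domain (D.second_mem U)) <|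
    D.sqrtA.domain.add_mem
      (D.sqrtA.domain.smul_mem _ (D.powφ_mem_sqrtA_domain _))
      (D.sqrtA.domain.smul_mem _ (D.powφ_mem_sqrtA_domain ⟨_, D.w_mem U⟩))

lemma sqrtA_first : D.sqrtA ⟨D.first U, D.A_domain_le_sqrtA_domain (D.first_mem U)⟩ =
    ((D.a ^ 2 : ℝ) : ℂ) • D.sqrtA (D.u U) + ((D.a ^ 2 * D.β : ℝ) : ℂ) • D.sqrtA (D.v U)
      - (D.η : ℂ) • D.powφ (D.sqrtA ⟨D.θ U, D.θ_mem U⟩) := by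
  rw [sqrtA_eq_iff]
  simp only [map_sub, map_add, map_smul, negPow_half_powφ, negPow_sqrtA]
  rfl

lemma sqrtA_second : D.sqrtA ⟨D.second U, D.A_domain_le_sqrtA_domain (D.second_mem U)⟩ =
    (D.η : ℂ) • D.powφ (D.sqrtA (D.v U) + (D.α : ℂ) • D.sqrtA ⟨D.w U, D.w_mem U⟩)
      + D.sqrtA ⟨D.θ U, D.θ_mem U⟩ := by
  rw [sqrtA_eq_iff]
  simp only [map_add, map_smul, negPow_half_powφ, negPow_sqrtA, smul_add, smul_smul,
    mul_comm (D.η : ℂ), ← Complex.ofReal_mul]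
  rfl

lemma inner_𝔹_self : inner ℂ (D.𝔹 U) (U : D.PhaseSpace) =
    ((D.a ^ 2 * D.α * (D.β - D.α) : ℝ) : ℂ) *
        inner ℂ (D.sqrtA ⟨D.w U, D.w_mem U⟩) (D.sqrtA (D.v U))
      + ((D.a ^ 2 : ℝ) : ℂ) *
        inner ℂ (D.sqrtA (D.v U) + (D.α : ℂ) • D.sqrtA ⟨D.w U, D.w_mem U⟩)
          (D.sqrtA (D.u U) + (D.α : ℂ) • D.sqrtA (D.v U))
      - inner ℂ (D.A ⟨D.first U, D.first_mem U⟩) ((D.v U : H) + (D.α : ℂ) • D.w U)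
      - inner ℂ (D.A ⟨D.second U, D.second_mem U⟩) (D.θ U) := by
  have hα : (D.α : ℂ) ≠ 0 := Complex.ofReal_ne_zero.2 D.α_pos.ne'
  have hthird : (D.v (D.𝔹 U) : H) + (D.α : ℂ) • D.w (D.𝔹 U) =
      -D.A ⟨D.first U, D.first_mem U⟩ := by
    change D.w U + (D.α : ℂ) •
      -((D.α : ℂ)⁻¹ • (D.A ⟨D.first U, D.first_mem U⟩ + D.w U)) = _
    rw [smul_neg, smul_inv_smul₀ hα, neg_add_rev, add_neg_cancel_left]
  have hfourth : D.θ (D.𝔹 U) = -D.A ⟨D.second U, D.second_mem U⟩ := rfl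
  rw [inner_def, hthird, hfourth, inner_neg_left, inner_neg_left, ← sub_eq_add_neg,
    ← sub_eq_add_neg]
  rfl

lemma re_inner_𝔹_self : (inner ℂ (D.𝔹 U) (U : D.PhaseSpace)).re =
    -(D.a ^ 2 * (D.β - D.α) * ‖D.sqrtA (D.v U)‖ ^ 2) - ‖D.sqrtA ⟨D.θ U, D.θ_mem U⟩‖ ^ 2 := by
  have hfirst := D.inner_A_left ⟨D.first U, D.first_mem U⟩
    (D.v U + (D.α : ℂ) • ⟨D.w U, D.w_mem U⟩)
  have hsecond := D.inner_A_left ⟨D.second U, D.second_mem U⟩ ⟨D.θ U, D.θ_mem U⟩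
  rw [LinearPMap.map_add, LinearPMap.map_smul, sqrtA_first] at hfirst
  rw [sqrtA_second] at hsecond
  rw [inner_𝔹_self, ← energy_identity (D.isSymmetric_negPow (1 - D.φ)) D.a D.α D.β D.η]
  exact congrArg Complex.re (congrArg₂ _ (congrArg _ hfirst) hsecond)

lemma isDissipative_𝔹 : IsDissipative D.𝔹 := fun U => by
  have hβ : 0 ≤ D.β - D.α := sub_nonneg.2 D.α_lt_β.le
  rw [re_inner_𝔹_self, ← neg_add', neg_nonpos]
  positivity

end Dissipative

section Surjective

lemma exists_A_eq {x y : H} (h : x = boundedInverse D.A y) :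
    ∃ hx : x ∈ D.A.domain, D.A ⟨x, hx⟩ = y := by
  subst h
  exact D.inv_spec.right_inv y

lemma exists_𝔹_eq {U F : D.PhaseSpace} (hv : D.v U = D.u F) (hw : D.w U = D.v F)
    (hfirst : D.first U = boundedInverse D.A (-((D.α : ℂ) • D.w F + D.v F)))
    (hsecond : D.second U = boundedInverse D.A (-D.θ F)) :
    ∃ hU : U ∈ D.𝔹.domain, D.𝔹 ⟨U, hU⟩ = F := by
  have hα : (D.α : ℂ) ≠ 0 := Complex.ofReal_ne_zero.2 D.α_pos.ne'
  obtain ⟨hfirst_mem, hAfirst⟩ := D.exists_A_eq hfirst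
  obtain ⟨hsecond_mem, hAsecond⟩ := D.exists_A_eq hsecond
  have hw_mem : D.w U ∈ D.sqrtA.domain := hw ▸ (D.v F).2
  refine ⟨⟨⟨hw_mem, hfirst_mem⟩, hsecond_mem⟩, D.ext_of hv (Subtype.ext hw) ?_ ?_⟩
  · change -((D.α : ℂ)⁻¹ • (D.A ⟨D.first U, hfirst_mem⟩ + D.w U)) = D.w F
    rw [hAfirst, hw, neg_add, neg_add_cancel_right, smul_neg, neg_neg, inv_smul_smul₀ hα]
  · change -D.A ⟨D.second U, hsecond_mem⟩ = D.θ F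
    rw [hAsecond, neg_neg]

lemma boundedInverse_mem_sqrtA_domain (x : H) : boundedInverse D.A x ∈ D.sqrtA.domain :=
  D.A_domain_le_sqrtA_domain (D.inv_spec.right_inv x).1

lemma surjective_𝔹 : Function.Surjective D.𝔹 := fun F => by
  have ha : ((D.a ^ 2 : ℝ) : ℂ) ≠ 0 := Complex.ofReal_ne_zero.2 D.sq_pos.ne'
  let Pφ (x : D.sqrtA.domain) : D.sqrtA.domain := ⟨D.powφ x, D.powφ_mem_sqrtA_domain x⟩
  let A_inv (x : H) : D.sqrtA.domain := ⟨_, D.boundedInverse_mem_sqrtA_domain x⟩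
  let θ : D.sqrtA.domain := A_inv (-D.θ F)
    - ((D.η : ℂ) • Pφ (D.u F) + ((D.α * D.η : ℝ) : ℂ) • Pφ (D.v F))
  let u : D.sqrtA.domain := ((D.a ^ 2 : ℝ) : ℂ)⁻¹ • (A_inv (-((D.α : ℂ) • D.w F + D.v F))
    - ((D.a ^ 2 * D.β : ℝ) : ℂ) • D.u F + (D.η : ℂ) • Pφ θ)
  let U : D.PhaseSpace := (u, D.u F, (D.v F : H), (θ : H))
  have hfirst : D.first U = boundedInverse D.A (-((D.α : ℂ) • D.w F + D.v F)) := by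
    have hu : ((D.a ^ 2 : ℝ) : ℂ) • u + ((D.a ^ 2 * D.β : ℝ) : ℂ) • D.u F - (D.η : ℂ) • Pφ θ =
        A_inv (-((D.α : ℂ) • D.w F + D.v F)) := by
      rw [smul_inv_smul₀ ha]
      abel
    exact congrArg Subtype.val hu
  have hsecond : D.second U = boundedInverse D.A (-D.θ F) :=
    congrArg Subtype.val (add_sub_cancel _ _ : _ + θ = A_inv (-D.θ F))
  obtain ⟨hU, hF⟩ := D.exists_𝔹_eq (U := U) rfl rfl hfirst hsecond
  exact ⟨_, hF⟩

lemma zero_mem_resolventSet_𝔹 : 0 ∈ resolventSet D.𝔹 :=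
  D.isDissipative_𝔹.zero_mem_resolventSet D.surjective_𝔹

end Surjective

end System

end MGTFourier

end

theorem theorem3 {H : Type*} [NormedAddCommGroup H] [InnerProductSpace ℂ H] [CompleteSpace H]
    (D : MGTFourier.System H) :
    Dense (D.𝔹.domain : Set D.PhaseSpace) ∧ MGTFourier.IsDissipative D.𝔹 ∧
    0 ∈ MGTFourier.resolventSet D.𝔹 ∧
    ∃ S : ℝ≥0 → D.PhaseSpace →L[ℂ] D.PhaseSpace,
      MGTFourier.IsC0ContractionSemigroup S ∧ MGTFourier.IsGenerator D.𝔹 S ∧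
      ∀ U₀ : D.PhaseSpace, ∃ U : ℝ → D.PhaseSpace,
        MGTFourier.IsWeakSolution D.𝔹 U₀ U ∧
        (∀ W : ℝ → D.PhaseSpace, MGTFourier.IsWeakSolution D.𝔹 U₀ W →
          Set.EqOn W U (Set.Ici 0)) ∧
        (∀ t : ℝ≥0, U t = S t U₀) ∧
        ∀ k : ℕ, U₀ ∈ (MGTFourier.opPow D.𝔹 k).domain →
          ∀ j : ℕ, j ≤ k →
            MGTFourier.ContDiffInDomain (MGTFourier.opPow D.𝔹 j) (k - j) U := by
  have hdiss := D.isDissipative_𝔹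
  have hzero := D.zero_mem_resolventSet_𝔹
  have h := hdiss.isMaximalDissipative hzero
  refine ⟨h.dense_domain, hdiss, hzero, h.semigroup, h.isC0ContractionSemigroup,
    h.isGenerator_semigroup, fun U₀ => ?_⟩
  have hweak := h.isWeakSolution_semigroup U₀
  exact ⟨fun t => h.semigroup t.toNNReal U₀, hweak,
    fun W hW => h.eqOn_of_isWeakSolution hweak hW,
    fun _ => congrArg (h.semigroup · U₀) Real.toNNReal_coe,
    fun k hk j hjk => h.contDiffInDomain_semigroup hjk hk⟩
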